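/- Let $\Bbbk$ be an algebraically closed field of characteristic $0$; all rings and fields below are $\Bbbk$-algebras. Let $\Gamma$ be a normal noetherian commutative domain with field of fractions $K$, let $L/K$ be a finite Galois extension with group $G$, let $\bar\Gamma$ be the integral closure of $\Gamma$ in $L$, and let $\mathcal M\subset\operatorname{Aut}_{\Bbbk}L$ be a submonoid which is closed under conjugation by $G$ and separating (elements of $\mathcal M$ with the same restriction to $K$ are equal). Let $L*\mathcal M$ be the skew monoid ring, with $(l_1\varphi_1)(l_2\varphi_2)=l_1\varphi_1(l_2)\,\varphi_1\varphi_2$, and let $\mathcal K=(L*\mathcal M)^G$, where $G$ acts on coefficients and by conjugation on $\mathcal M$. Let $U$ be a Galois order over $\Gamma$: a subring of $\mathcal K$ which contains $\Gamma$ and is finitely generated over it, such that $KU=UK=\mathcal K$, and such that for every finite-dimensional right (respectively left) $K$-subspace $W\subset\mathcal K$ the right (respectively left) $\Gamma$-module $W\cap U$ is finitely generated. For $\mathfrak m,\mathfrak n\in\operatorname{Specm}\Gamma$ choose maximal ideals $\ell_{\mathfrak m},\ell_{\mathfrak n}$ of $\bar\Gamma$ lying over $\mathfrak m,\mathfrak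 n$ and put $$S(\mathfrak m,\mathfrak n)=\{\varphi\in\mathcal M \mid \varphi g_1\ell_{\mathfrak m}=g_2\ell_{\mathfrak n}\text{ for some }g_1,g_2\in G\},$$ $$U(S)=\Big\{\sum_{\varphi}u_\varphi\varphi\in U \;\Big|\; u_\varphi\neq0\Rightarrow\varphi\in S\Big\}.$$ For a $\Gamma$-bimodule (that is, a $\Gamma\otimes_{\Bbbk}\Gamma$-module) $V$ let ${}_{\mathfrak n}\hat V_{\mathfrak m}$ be its completion at the ideal $\mathfrak n\otimes\Gamma+\Gamma\otimes\mathfrak m$, equivalently $\varprojlim_{a,b}V/(\mathfrak n^aV+V\mathfrak m^b)$, and put $$\mathcal A(\mathfrak m,\mathfrak n)=\varinjlim_V {}_{\mathfrak n}\hat V_{\mathfrak m},$$ where $V$ runs over the finitely generated $\Gamma$-subbimodules of $U$. It is a left module over $\hat\Gamma_{\mathfrak n}=\varprojlim_a\Gamma/\mathfrak n^a$, a right module over $\hat\Gamma_{\mathfrak m}$, and a module over the completion of $\Gamma\otimes_{\Bbbk}\Gamma$ at $\mathfrak n\otimes\Gamma+\Gamma\otimes\mathfrak m$. Suppose that $S=S(\mathfrak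 m,\mathfrak n)$ is finite. Then: 1. $\mathcal A(\mathfrak m,\mathfrak n)$ is finitely generated as a module over the completion of $\Gamma\otimes_{\Bbbk}\Gamma$ at $\mathfrak n\otimes\Gamma+\Gamma\otimes\mathfrak m$, as a left $\hat\Gamma_{\mathfrak n}$-module, and as a right $\hat\Gamma_{\mathfrak m}$-module. 2. $\mathcal A(\mathfrak m,\mathfrak n)$ is the completed image of $U(S)$: the bimodule $U(S)$ is finitely generated, the canonical map ${}_{\mathfrak n}\widehat{U(S)}_{\mathfrak m}\to\mathcal A(\mathfrak m,\mathfrak n)$ is surjective, and the image of $U(S)$ itself generates $\mathcal A(\mathfrak m,\mathfrak n)$ both as a left $\hat\Gamma_{\mathfrak n}$-module and as a right $\hat\Gamma_{\mathfrak m}$-module. 3. If $S\neq\varnothing$ (in particular if $\mathfrak n=\mathfrak m$, where $1\in S$), then $\Gamma$ is big in $\mathfrak m$, that is, $\mathcal A(\mathfrak m,\mathfrak m)$ is a finitely generated right $\hat\Gamma_{\mathfrak m}$-module; and there are only finitely many isomorphism classes of simple left $U$-modules $N$ with $N(\mathfrak m)=\{v\in N\mid \mathfrak m^rv=0\text{ for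 some }r\ge0\}\neq0$. -/

import Mathlib

open scoped TensorProduct

noncomputable section

namespace GaloisOrder

section OneSided

variable {A R : Type*} [CommRing A] [Ring R]

/-- `R` as a left `A`-module through a ring homomorphism `j : A → R`. -/
abbrev leftModule (j : A →+* R) : Module A R := Module.compHom R j

/-- `R` as a right `A`-module through a ring homomorphism `j : A → R`, so that
`op a • x = x * j a`. -/
abbrev rightModule (j : A →+* R) : Module Aᵐᵒᵖ R := Module.compHom R (RingHom.op j)

/-- The additive subgroup `W` of `R` is a finitely generated left `A`-submodule. -/
def IsLeftFG (j : A →+* R) (W : AddSubgroup R) : Prop :=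
  letI := leftModule j
  ∃ P : Submodule A R, P.FG ∧ P.toAddSubgroup = W

/-- The additive subgroup `W` of `R` is a finitely generated right `A`-submodule. -/
def IsRightFG (j : A →+* R) (W : AddSubgroup R) : Prop :=
  letI := rightModule j
  ∃ P : Submodule Aᵐᵒᵖ R, P.FG ∧ P.toAddSubgroup = W

end OneSided

/-! ### Galois rings and Galois orders -/

section GaloisRing

variable {k L : Type*} [Field k] [Field L] [Algebra k L]

/-- The embedding `a ↦ a · e` of a `k`-algebra `A` that maps to `L` into the skew monoid ring
`L * M`. -/
def coeffEmb (A : Type*) [CommRing A] [Algebra k A] [Algebra A L] [IsScalarTower k A L]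
    (M : Submonoid (L ≃ₐ[k] L)) : A →ₐ[k] SkewMonoidAlgebra L M where
  __ := (SkewMonoidAlgebra.singleOneRingHom (k := L) (G := M)).comp (algebraMap A L)
  commutes' r := by
    change SkewMonoidAlgebra.single (1 : M) (algebraMap A L (algebraMap k A r)) = _
    rw [← IsScalarTower.algebraMap_apply k A L]
    rfl

lemma coeffEmb_apply (A : Type*) [CommRing A] [Algebra k A] [Algebra A L] [IsScalarTower k A L]
    (M : Submonoid (L ≃ₐ[k] L)) (a : A) :
    coeffEmb A M a = SkewMonoidAlgebra.single 1 (algebraMap A L a) := rfl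

variable (K : Type*) [Field K] [Algebra K L] [Algebra k K] [IsScalarTower k K L]

/-- `M` is closed under conjugation by the Galois group of `L / K`. -/
def ConjClosed (M : Submonoid (L ≃ₐ[k] L)) : Prop :=
  ∀ g : L ≃ₐ[K] L, ∀ φ ∈ M, g.restrictScalars k * φ * (g.restrictScalars k)⁻¹ ∈ M

/-- Elements of `M` are determined by their restriction to `K`. -/
def Separating (M : Submonoid (L ≃ₐ[k] L)) : Prop :=
  ∀ φ ∈ M, ∀ ψ ∈ M,
    (∀ x : K, φ (algebraMap K L x) = ψ (algebraMap K L x)) → φ = ψ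

/-- The invariants `(L * M)^G`, `G = Gal(L / K)`: the group acts on coefficients and by
conjugation on `M`, so `x` is invariant iff `x_{g φ g⁻¹} = g (x_φ)`. -/
def invariants (M : Submonoid (L ≃ₐ[k] L)) : Submodule k (SkewMonoidAlgebra L M) where
  carrier := {x | ∀ (g : L ≃ₐ[K] L) (φ ψ : M),
    (ψ : L ≃ₐ[k] L) = g.restrictScalars k * φ * (g.restrictScalars k)⁻¹ →
      x.coeff ψ = g (x.coeff φ)}
  add_mem' {x y} hx hy g φ ψ h := by
    simp [hx g φ ψ h, hy g φ ψ h]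
  zero_mem' g φ ψ h := by simp
  smul_mem' c x hx g φ ψ h := by
    have hc : g (algebraMap k L c) = algebraMap k L c := (g.restrictScalars k).commutes c
    have key : ∀ χ : M, (c • x).coeff χ = algebraMap k L c * x.coeff χ := fun χ => by
      rw [Algebra.smul_def]
      exact SkewMonoidAlgebra.coeff_single_one_mul x (algebraMap k L c) χ
    rw [key, key, map_mul, hc, hx g φ ψ h]

variable (Γ : Type*) [CommRing Γ] [Algebra k Γ] [Algebra Γ L] [IsScalarTower k Γ L]

/-- `U` is a Galois ring over `Γ`: a subring of the invariants `𝒦 = (L * M)^G` containing `Γ`,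
finitely generated over `Γ`, with `K U = U K = 𝒦`. -/
structure IsGaloisRing (M : Submonoid (L ≃ₐ[k] L))
    (U : Subalgebra k (SkewMonoidAlgebra L M)) : Prop where
  base_le : (coeffEmb Γ M).range ≤ U
  le_invariants : Subalgebra.toSubmodule U ≤ invariants K M
  fg : ∃ F : Finset (SkewMonoidAlgebra L M),
    U = Algebra.adjoin k (Set.range (coeffEmb Γ M) ∪ (F : Set (SkewMonoidAlgebra L M)))
  left_span : Subalgebra.toSubmodule (coeffEmb K M).range * Subalgebra.toSubmodule U =
    invariants K M
  right_span : Subalgebra.toSubmodule U * Subalgebra.toSubmodule (coeffEmb K M).range =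
    invariants K M

/-- `U` is a Galois order over `Γ`: a Galois ring meeting every finite-dimensional right
(left) `K`-subspace of `𝒦` in a finitely generated right (left) `Γ`-module. -/
structure IsGaloisOrder (M : Submonoid (L ≃ₐ[k] L))
    (U : Subalgebra k (SkewMonoidAlgebra L M)) : Prop extends IsGaloisRing K Γ M U where
  right_order : ∀ W : AddSubgroup (SkewMonoidAlgebra L M),
    W ≤ (invariants K M).toAddSubgroup → IsRightFG (coeffEmb K M : K →+* _) W →
      IsRightFG (coeffEmb Γ M : Γ →+* _) (W ⊓ (Subalgebra.toSubmodule U).toAddSubgroup)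
  left_order : ∀ W : AddSubgroup (SkewMonoidAlgebra L M),
    W ≤ (invariants K M).toAddSubgroup → IsLeftFG (coeffEmb K M : K →+* _) W →
      IsLeftFG (coeffEmb Γ M : Γ →+* _) (W ⊓ (Subalgebra.toSubmodule U).toAddSubgroup)

variable {K Γ} in
/-- The embedding of `Γ` into a Galois ring. -/
def IsGaloisRing.incl {M : Submonoid (L ≃ₐ[k] L)} {U : Subalgebra k (SkewMonoidAlgebra L M)}
    (hU : IsGaloisRing K Γ M U) : Γ →ₐ[k] U :=
  (coeffEmb Γ M).codRestrict U fun γ => hU.base_le ⟨γ, rfl⟩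

variable {Γ} in
/-- The image in `L` of a maximal ideal of the integral closure of `Γ` in `L`. -/
def idealSet (ℓ : MaximalSpectrum (integralClosure Γ L)) : Set L :=
  (fun x : integralClosure Γ L => (x : L)) '' (ℓ.asIdeal : Set (integralClosure Γ L))

variable {Γ} in
/-- For `ℓm`, `ℓn` lying over `m`, `n`, the set
`S(m, n) = {φ ∈ M | φ g₁ ℓm = g₂ ℓn for some g₁, g₂ ∈ Gal(L / K)}`. -/
def linkSet (M : Submonoid (L ≃ₐ[k] L)) (ℓm ℓn : MaximalSpectrum (integralClosure Γ L)) :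
    Set M :=
  {φ | ∃ g₁ g₂ : L ≃ₐ[K] L, (φ : L ≃ₐ[k] L) '' (g₁ '' idealSet ℓm) = g₂ '' idealSet ℓn}

end GaloisRing

/-! ### The category `𝒜` attached to a commutative subalgebra -/

section Category

variable {k Γ U : Type*} [Field k] [CommRing Γ] [Algebra k Γ] [Ring U] [Algebra k U]

/-- Right multiplication by elements of `Γ`, as a homomorphism since `Γ` is commutative. -/
def rightMulHom (i : Γ →ₐ[k] U) : Γ →ₐ[k] Module.End k U :=
  AlgHom.ofLinearMap ((LinearMap.mul k U).flip ∘ₗ i.toLinearMap)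
    (by ext x; simp)
    (by intro x y; ext u; simp [← mul_assoc, mul_comm x y])

/-- The action of `Γ ⊗ Γ` on `U`, with `γ ⊗ δ` acting as `u ↦ γ u δ`. -/
def bimoduleHom (i : Γ →ₐ[k] U) : Γ ⊗[k] Γ →ₐ[k] Module.End k U :=
  Algebra.TensorProduct.lift ((Algebra.lmul k U).comp i) (rightMulHom i)
    (by intro x y; ext u; simp [rightMulHom, mul_assoc])

lemma bimoduleHom_tmul (i : Γ →ₐ[k] U) (γ δ : Γ) (u : U) :
    bimoduleHom i (γ ⊗ₜ δ) u = i γ * u * i δ := by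
  simp [bimoduleHom, rightMulHom, mul_assoc]

/-- `U` regarded as a `Γ`-bimodule, that is, as a `Γ ⊗ Γ`-module. -/
@[nolint unusedArguments]
def Bimod (_ : Γ →ₐ[k] U) : Type _ := U

variable (i : Γ →ₐ[k] U)

instance : AddCommGroup (Bimod i) := inferInstanceAs (AddCommGroup U)

instance : Module (Γ ⊗[k] Γ) (Bimod i) :=
  letI : Module (Module.End k U) (Bimod i) := inferInstanceAs (Module (Module.End k U) U)
  Module.compHom (Bimod i) (bimoduleHom i : Γ ⊗[k] Γ →+* Module.End k U)

/-- The identity map from `U` as a bimodule to `U`. -/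
def Bimod.toRing : Bimod i ≃+ U := AddEquiv.refl U

variable {i} in
lemma Bimod.toRing_tmul_smul (γ δ : Γ) (u : Bimod i) :
    Bimod.toRing i ((γ ⊗ₜ[k] δ : Γ ⊗[k] Γ) • u) = i γ * Bimod.toRing i u * i δ :=
  bimoduleHom_tmul i γ δ u

/-- The ideal `I = n ⊗ Γ + Γ ⊗ m` of `Γ ⊗ Γ`. -/
def biIdeal (k : Type*) [Field k] {Γ : Type*} [CommRing Γ] [Algebra k Γ]
    (m n : MaximalSpectrum Γ) : Ideal (Γ ⊗[k] Γ) :=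
  n.asIdeal.map (Algebra.TensorProduct.includeLeft : Γ →ₐ[k] Γ ⊗[k] Γ) ⊔
    m.asIdeal.map (Algebra.TensorProduct.includeRight : Γ →ₐ[k] Γ ⊗[k] Γ)

/-- The completion of `Γ ⊗ Γ` at `I = n ⊗ Γ + Γ ⊗ m`. -/
abbrev BiCompletion (k : Type*) [Field k] {Γ : Type*} [CommRing Γ] [Algebra k Γ]
    (m n : MaximalSpectrum Γ) : Type _ :=
  AdicCompletion (biIdeal k m n) (Γ ⊗[k] Γ)

/-- The poset of finitely generated subbimodules of `U`. -/
abbrev FGSub : Type _ := {V : Submodule (Γ ⊗[k] Γ) (Bimod i) // V.FG}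

instance : DecidableEq (FGSub i) := Classical.decEq _

/-- The morphism space `𝒜(m, n)`: the direct limit, over the finitely generated subbimodules
`V` of `U`, of the `(n ⊗ Γ + Γ ⊗ m)`-adic completions of `V`. -/
def HomSpace (m n : MaximalSpectrum Γ) : Type _ :=
  Module.DirectLimit (R := BiCompletion k m n) (ι := FGSub i)
    (fun V => AdicCompletion (biIdeal k m n) V.1)
    (fun _ _ h => AdicCompletion.map (biIdeal k m n) (Submodule.inclusion h))

instance (m n : MaximalSpectrum Γ) : AddCommGroup (HomSpace i m n) :=
  inferInstanceAs (AddCommGroup (Module.DirectLimit (R := BiCompletion k m n) (ι := FGSub i)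
    (fun V => AdicCompletion (biIdeal k m n) V.1)
    (fun _ _ h => AdicCompletion.map (biIdeal k m n) (Submodule.inclusion h))))

instance (m n : MaximalSpectrum Γ) : Module (BiCompletion k m n) (HomSpace i m n) :=
  inferInstanceAs (Module (BiCompletion k m n)
    (Module.DirectLimit (R := BiCompletion k m n) (ι := FGSub i)
    (fun V => AdicCompletion (biIdeal k m n) V.1)
    (fun _ _ h => AdicCompletion.map (biIdeal k m n) (Submodule.inclusion h))))

/-- The canonical map to `𝒜(m, n)` from the completion of a finitely generated subbimodule. -/
def HomSpace.of (m n : MaximalSpectrum Γ) (V : FGSub i) :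
    AdicCompletion (biIdeal k m n) V.1 →ₗ[BiCompletion k m n] HomSpace i m n :=
  Module.DirectLimit.of (BiCompletion k m n) (FGSub i)
    (fun V => AdicCompletion (biIdeal k m n) V.1)
    (fun _ _ h => AdicCompletion.map (biIdeal k m n) (Submodule.inclusion h)) V

/-- The image of `u ∈ U` in `𝒜(m, n)`. -/
def HomSpace.ofElem (m n : MaximalSpectrum Γ) (u : Bimod i) : HomSpace i m n :=
  HomSpace.of i m n ⟨Submodule.span _ {u}, Submodule.fg_span (Set.finite_singleton u)⟩
    (AdicCompletion.of (biIdeal k m n) _ ⟨u, Submodule.mem_span_singleton_self u⟩)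

/-- A ring homomorphism taking `I` into `J` induces a homomorphism of adic completions. -/
def completionMap {A B : Type*} [CommRing A] [CommRing B] (I : Ideal A) (J : Ideal B)
    (f : A →+* B) (h : I ≤ J.comap f) : AdicCompletion I A →+* AdicCompletion J B :=
  AdicCompletion.liftRingHom J
    (fun a => (Ideal.quotientMap (J ^ a) f
      ((Ideal.pow_right_mono h a).trans (Ideal.le_comap_pow f a))).comp
        (AdicCompletion.evalₐ I a : AdicCompletion I A →+* A ⧸ I ^ a))
    (by
      intro a b hab
      ext x
      obtain ⟨z, rfl⟩ := AdicCompletion.mk_surjective I A x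
      have hz : z.val a - z.val b ∈ I ^ a := by
        have h1 := z.property hab
        rwa [SModEq.sub_mem, smul_eq_mul, Ideal.mul_top] at h1
      simp only [RingHom.comp_apply, RingHom.coe_coe, AdicCompletion.evalₐ_mk,
        Ideal.quotientMap_mk]
      change Ideal.Quotient.mk (J ^ a) (f (z.val b)) = Ideal.Quotient.mk (J ^ a) (f (z.val a))
      rw [eq_comm, Ideal.Quotient.eq, ← map_sub]
      exact Ideal.le_comap_pow f a (Ideal.pow_right_mono h a hz))

/-- `Γ̂_n → (Γ ⊗ Γ)^`, induced by `γ ↦ γ ⊗ 1`. -/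
def leftHom (k : Type*) [Field k] {Γ : Type*} [CommRing Γ] [Algebra k Γ]
    (m n : MaximalSpectrum Γ) : AdicCompletion n.asIdeal Γ →+* BiCompletion k m n :=
  completionMap n.asIdeal (biIdeal k m n)
    ((Algebra.TensorProduct.includeLeft : Γ →ₐ[k] Γ ⊗[k] Γ) : Γ →+* Γ ⊗[k] Γ)
    (Ideal.le_comap_of_map_le le_sup_left)

/-- `Γ̂_m → (Γ ⊗ Γ)^`, induced by `γ ↦ 1 ⊗ γ`. -/
def rightHom (k : Type*) [Field k] {Γ : Type*} [CommRing Γ] [Algebra k Γ]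
    (m n : MaximalSpectrum Γ) : AdicCompletion m.asIdeal Γ →+* BiCompletion k m n :=
  completionMap m.asIdeal (biIdeal k m n)
    ((Algebra.TensorProduct.includeRight : Γ →ₐ[k] Γ ⊗[k] Γ) : Γ →+* Γ ⊗[k] Γ)
    (Ideal.le_comap_of_map_le le_sup_right)

/-- `𝒜(m, n)` as a left `Γ̂_n`-module. -/
instance (m n : MaximalSpectrum Γ) :
    Module (AdicCompletion n.asIdeal Γ) (HomSpace i m n) :=
  Module.compHom (HomSpace i m n) (leftHom k m n)

/-- `𝒜(m, n)` as a right `Γ̂_m`-module. -/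
instance (m n : MaximalSpectrum Γ) :
    Module (AdicCompletion m.asIdeal Γ)ᵐᵒᵖ (HomSpace i m n) :=
  Module.compHom (HomSpace i m n)
    ((rightHom k m n).comp
      ((RingEquiv.toOpposite (AdicCompletion m.asIdeal Γ)).symm : _ →+* _))

/-- `Γ` is big in `m`: `𝒜(m, m)` is finitely generated as a right `Γ̂_m`-module. -/
def IsBig (m : MaximalSpectrum Γ) : Prop :=
  Module.Finite (AdicCompletion m.asIdeal Γ)ᵐᵒᵖ (HomSpace i m m)

/-- The `m`-component `M(m) = {v | m ^ r v = 0 for some r}` of a `U`-module `M` is nonzero. -/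
def HasWeight (m : MaximalSpectrum Γ) (M : Type*) [AddCommGroup M] [Module U M] : Prop :=
  ∃ v : M, v ≠ 0 ∧ ∃ r : ℕ, ∀ γ ∈ m.asIdeal ^ r, i γ • v = 0

end Category

/-! ### Elements of a Galois ring with prescribed support -/

section Support

variable {k L : Type*} [Field k] [Field L] [Algebra k L]
  {K : Type*} [Field K] [Algebra K L] [Algebra k K] [IsScalarTower k K L]
  {Γ : Type*} [CommRing Γ] [Algebra k Γ] [Algebra Γ L] [IsScalarTower k Γ L]
  {M : Submonoid (L ≃ₐ[k] L)} {U : Subalgebra k (SkewMonoidAlgebra L M)}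

/-- The subbimodule `U(S) = {u ∈ U | supp u ⊆ S}` of a Galois ring `U`. -/
def supportSub (hU : IsGaloisRing K Γ M U) (S : Set M) :
    Submodule (Γ ⊗[k] Γ) (Bimod hU.incl) where
  carrier := {u | ∀ φ : M,
    (Bimod.toRing hU.incl u : SkewMonoidAlgebra L M).coeff φ ≠ 0 → φ ∈ S}
  add_mem' {x y} hx hy φ h := by
    by_contra hφ
    have h1 := not_imp_not.mpr (hx φ) hφ
    have h2 := not_imp_not.mpr (hy φ) hφ
    simp_all
  zero_mem' φ h := by simp at h
  smul_mem' c x hx := by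
    induction c using TensorProduct.induction_on with
    | zero => intro φ h; simp at h
    | add a b ha hb =>
      intro φ h
      by_contra hφ
      have h1 := not_imp_not.mpr (ha φ) hφ
      have h2 := not_imp_not.mpr (hb φ) hφ
      rw [add_smul] at h
      simp_all
    | tmul γ δ =>
      intro φ h
      rw [Bimod.toRing_tmul_smul] at h
      refine hx φ fun h0 => h ?_
      change (SkewMonoidAlgebra.single (1 : M) (algebraMap Γ L γ) *
        (Bimod.toRing hU.incl x : SkewMonoidAlgebra L M) *
        SkewMonoidAlgebra.single (1 : M) (algebraMap Γ L δ)).coeff φ = 0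
      rw [SkewMonoidAlgebra.coeff_mul_single_one, SkewMonoidAlgebra.coeff_single_one_mul, h0]
      simp

end Support

end GaloisOrder

end

/-!
Put `I = n ⊗ Γ + Γ ⊗ m`. An element of `Γ ⊗ Γ` acts on the coefficient of a skew polynomial at `φ`
through the character `γ ⊗ δ ↦ γ * φ δ`, and every element of `1 + I` is invertible in the
completion at `I`. The kernel of the character is comaximal with `I` unless `φ ∈ S`: a common
maximal ideal gives, by lying over and the transitivity of the Galois group on the primes above
`m` and `n`, elements `g₁`, `g₂` with `φ (g₁ ℓm) = g₂ ℓn`. Here the order condition enters, through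
the integrality of `φ Γ` over `Γ`. So some element of `1 + I` moves a given finitely generated
subbimodule of `U` into `U(S)`, and the completion of `U(S)` surjects onto `𝒜(m, n)`.

By the order condition `U(S)` is finite over `Γ` on either side. If `V` is such a bimodule, a
surjection `Γ ^ r → V` pulls the `I`-adic filtration back to one coarser than the `n`-adic
filtration; as `Γ ^ r / n ^ a Γ ^ r` is artinian, a sequence that is Cauchy for the former can be
corrected to one that is Cauchy for the latter, so the `n`-adic completion of `Γ ^ r` surjects onto
the completion of `V`.

A simple module with a nonzero `m`-component contains a nonzero vector killed by `m`, so it is a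
quotient of `X = U / U m`. The `m`-component of `X` is artinian, so some finite intersection `D` of
maximal submodules has the least trace on it, and `D` lies in every maximal submodule `P`:
otherwise the generator of `X` is `p + d` with `p ∈ P` and `d ∈ D`, and an element of `1 + m`, which
fixes the generator, can be chosen to move `d` into the `m`-component and hence into `P`. So `X` has
only finitely many simple quotients up to isomorphism.
-/

namespace GaloisOrder

section AdicCompletion

theorem isArtinian_of_pow_le_annihilator {R X : Type*} [CommRing R] [AddCommGroup X] [Module R X]
    [IsNoetherian R X] (m : Ideal R) [m.IsMaximal] {c : ℕ}
    (h : m ^ c ≤ Module.annihilator R X) : IsArtinian R X := by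
  induction c generalizing X with
  | zero =>
    have : Subsingleton X := by
      rwa [pow_zero, Ideal.one_eq_top, top_le_iff, Module.annihilator_eq_top_iff] at h
    infer_instance
  | succ c ih =>
    rw [isArtinian_iff_submodule_quotient (m • ⊤ : Submodule R X)]
    constructor
    · apply ih
      rw [← Submodule.annihilator, Submodule.le_annihilator_iff, ← Submodule.mul_smul, ← pow_succ]
      rwa [← Submodule.annihilator_top, Submodule.le_annihilator_iff] at h
    · let : Field (R ⧸ m) := Ideal.Quotient.field m
      have : Module.Finite (R ⧸ m) (X ⧸ (m • ⊤ : Submodule R X)) :=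
        Module.Finite.of_restrictScalars_finite R _ _
      exact isArtinian_of_surjective_algebraMap (S := R) (R := R ⧸ m) Ideal.Quotient.mk_surjective

theorem exists_sup_pow_smul_top_stable {R X : Type*} [CommRing R] [AddCommGroup X] [Module R X]
    [IsNoetherian R X] (n : Ideal R) [n.IsMaximal] {N : ℕ → Submodule R X} (hN : Antitone N)
    (a : ℕ) : ∃ b₀, ∀ b, b₀ ≤ b → N b₀ ⊔ n ^ a • ⊤ = N b ⊔ n ^ a • ⊤ := by
  let Y : Submodule R X := n ^ a • ⊤
  have : IsArtinian R (X ⧸ Y) := isArtinian_of_pow_le_annihilator n (c := a) fun r hr ↦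
    Module.mem_annihilator.2 fun x ↦ by
      obtain ⟨x, rfl⟩ := Y.mkQ_surjective x
      rw [← map_smul, Submodule.mkQ_apply, Submodule.Quotient.mk_eq_zero]
      exact Submodule.smul_mem_smul hr trivial
  obtain ⟨b₀, hb₀⟩ := IsArtinian.monotone_stabilizes
    (⟨fun b ↦ OrderDual.toDual ((N b).map Y.mkQ), fun _ _ h ↦ Submodule.map_mono (hN h)⟩ :
      ℕ →o (Submodule R (X ⧸ Y))ᵒᵈ)
  refine ⟨b₀, fun b hb ↦ ?_⟩
  have h := congrArg (Submodule.comap Y.mkQ) (OrderDual.toDual.injective (hb₀ b hb))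
  simpa only [Submodule.comap_map_mkQ, sup_comm] using h

theorem exists_adicCauchySequence_sub_mem {R X : Type*} [CommRing R] [AddCommGroup X] [Module R X]
    [IsNoetherian R X] (n : Ideal R) [n.IsMaximal] {N : ℕ → Submodule R X} (hN : Antitone N)
    (hle : ∀ a, n ^ a • ⊤ ≤ N a) {y : ℕ → X} (hy : ∀ a b, a ≤ b → y b - y a ∈ N a) :
    ∃ s : AdicCompletion.AdicCauchySequence n X, ∀ a, s a - y a ∈ N a := by
  -- Any `c` satisfying this for `a` can be corrected by an element of `n ^ a • ⊤` so as to
  -- satisfy it for `a + 1`, because the chain `N b ⊔ n ^ (a + 1) • ⊤` is stationary.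
  let Approx (a : ℕ) (c : X) : Prop := ∀ b, c - y b ∈ N b ⊔ n ^ a • ⊤
  have approx_zero : Approx 0 0 := fun b ↦ by simp
  have step (a : ℕ) (c : X) (hc : Approx a c) :
      ∃ c', Approx (a + 1) c' ∧ c - c' ∈ n ^ a • (⊤ : Submodule R X) := by
    obtain ⟨b₀, hb₀⟩ := exists_sup_pow_smul_top_stable n hN (a + 1)
    obtain ⟨z, hz, d, hd, hzd⟩ := Submodule.mem_sup.1 (hc b₀)
    refine ⟨c - d, fun b ↦ ?_, by rwa [sub_sub_cancel]⟩
    have hzd' : c - d - y b = z + (y b₀ - y b) := by rw [eq_sub_of_add_eq hzd]; abel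
    rcases le_total b b₀ with hb | hb
    · exact Submodule.mem_sup_left (hzd' ▸ add_mem (hN hb hz) (hy b b₀ hb))
    · rw [← hb₀ b hb, hzd', ← neg_sub (y b), ← sub_eq_add_neg]
      exact Submodule.mem_sup_left (sub_mem hz (hy b₀ b hb))
  choose! next approx_next sub_next using step
  let s (a : ℕ) : X := Nat.rec 0 next a
  have approx_s (a : ℕ) : Approx a (s a) := by
    induction a with
    | zero => exact approx_zero
    | succ a ih => exact approx_next a _ ih
  refine ⟨.mk n X s fun a ↦ SModEq.sub_mem.2 (sub_next a _ (approx_s a)), fun a ↦ ?_⟩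
  exact (sup_eq_left.2 (hle a)).le (approx_s a a)

theorem exists_eq_sum_completionMap_smul_of {R A V ι : Type*} [CommRing R] [IsNoetherianRing R]
    [CommRing A] [AddCommGroup V] [Module A V] [Fintype ι] (n : Ideal R) [n.IsMaximal]
    (I : Ideal A) (f : R →+* A) (h : n ≤ I.comap f) (v : ι → V)
    (hv : ∀ x, ∃ c : ι → R, ∑ j, f (c j) • v j = x) (x : AdicCompletion I V) :
    ∃ c : ι → AdicCompletion n R,
      x = ∑ j, completionMap n I f h (c j) • AdicCompletion.of I V (v j) := by
  classical
  let : Algebra R A := f.toAlgebra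
  let : Module R V := Module.compHom V f
  have : IsScalarTower R A V := ⟨fun r a x ↦ mul_smul (f r) a x⟩
  let p : (ι → R) →ₗ[R] V := Fintype.linearCombination R v
  let N (a : ℕ) : Submodule R (ι → R) := ((I ^ a • ⊤ : Submodule A V).restrictScalars R).comap p
  have hN : Antitone N := fun a b hab c hc ↦
    Submodule.smul_mono_left (Ideal.pow_le_pow_right hab) hc
  have hle (a : ℕ) : n ^ a • ⊤ ≤ N a := Submodule.smul_le.2 fun r hr c _ ↦ by
    change p (r • c) ∈ (I ^ a • ⊤ : Submodule A V)
    rw [map_smul]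
    exact Submodule.smul_mem_smul
      (Ideal.le_comap_pow f a (Ideal.pow_right_mono h a hr)) Submodule.mem_top
  obtain ⟨x, rfl⟩ := AdicCompletion.mk_surjective I V x
  choose y hy using fun a ↦ hv (x a)
  replace hy (a : ℕ) : p (y a) = x a := hy a
  obtain ⟨s, hs⟩ := exists_adicCauchySequence_sub_mem n hN hle (y := y) fun a b hab ↦ by
    change p (y b - y a) ∈ (I ^ a • ⊤ : Submodule A V)
    rw [map_sub, hy, hy]
    exact SModEq.sub_mem.1 (x.2 hab).symm
  refine ⟨fun j ↦ AdicCompletion.map n (LinearMap.proj j) (AdicCompletion.mk n _ s),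
    AdicCompletion.ext fun a ↦ ?_⟩
  have hpx : p (s a) - x a ∈ (I ^ a • ⊤ : Submodule A V) := by
    rw [← hy, ← map_sub]
    exact hs a
  rw [AdicCompletion.val_sum_apply]
  exact ((Submodule.Quotient.eq _).2 hpx).symm.trans (map_sum (Submodule.mkQ _) _ _)

end AdicCompletion

section SimpleQuotients

theorem exists_linearEquiv_quotient_of_finset_inf_le {U X : Type*} [Ring U] [AddCommGroup X]
    [Module U X] {T : Finset (Submodule U X)} (hT : ∀ Q ∈ T, IsCoatom Q) {P : Submodule U X}
    (hP : IsCoatom P) (h : T.inf id ≤ P) : ∃ Q ∈ T, Nonempty ((X ⧸ P) ≃ₗ[U] X ⧸ Q) := by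
  classical
  have (Q : T) : IsSimpleModule U (X ⧸ (Q : Submodule U X)) :=
    isSimpleModule_iff_isCoatom.2 (hT Q Q.2)
  have : IsSimpleModule U (X ⧸ P) := isSimpleModule_iff_isCoatom.2 hP
  let f : X →ₗ[U] ∀ Q : T, X ⧸ (Q : Submodule U X) := LinearMap.pi fun Q ↦ Q.1.mkQ
  have hf : f.ker ≤ P := fun x hx ↦ h <| Submodule.mem_finsetInf.2 fun Q hQ ↦
    (Submodule.Quotient.mk_eq_zero Q).1 (congrFun hx ⟨Q, hQ⟩)
  obtain ⟨g, hg⟩ := IsSemisimpleModule.extension_property (f.ker.liftQ f le_rfl)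
    (LinearMap.ker_eq_bot.1 (Submodule.ker_liftQ_eq_bot' _ _ rfl))
    (f.ker.liftQ P.mkQ (by rwa [Submodule.ker_mkQ]))
  have hg₀ : g ≠ 0 := by
    rintro rfl
    refine hP.1 (Submodule.eq_top_iff'.2 fun x ↦ (Submodule.Quotient.mk_eq_zero P).1 ?_)
    exact (LinearMap.congr_fun hg (Submodule.Quotient.mk x)).symm
  obtain ⟨Q, hQ⟩ : ∃ Q : T, g ∘ₗ LinearMap.single U _ Q ≠ 0 := by
    contrapose! hg₀
    exact LinearMap.pi_ext' hg₀
  exact ⟨Q, Q.2, ⟨(LinearEquiv.ofBijective _ (LinearMap.bijective_of_ne_zero hQ)).symm⟩⟩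

section PowTorsion

variable {R : Type*} [CommRing R] (m : Ideal R) (X : Type*) [AddCommGroup X] [Module R X]

/-- The submodule of elements killed by some power of `m`; for a module over a Galois ring this
is its `m`-component. -/
def powTorsion : Submodule R X := ⨆ c : ℕ, Submodule.torsionBySet R X (m ^ c : Ideal R)

theorem directed_torsionBySet_pow :
    Directed (· ≤ ·) fun c : ℕ ↦ Submodule.torsionBySet R X (m ^ c : Ideal R) :=
  Monotone.directed_le fun _ _ h ↦ Submodule.torsionBySet_le_torsionBySet_of_subset
    (Ideal.pow_le_pow_right h)

variable {m X}

theorem mem_powTorsion {x : X} : x ∈ powTorsion m X ↔ ∃ c : ℕ, ∀ r ∈ m ^ c, r • x = 0 := by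
  rw [powTorsion, Submodule.mem_iSup_of_directed _ (directed_torsionBySet_pow m X)]
  simp only [Submodule.mem_torsionBySet_iff, SetLike.coe_sort_coe, Subtype.forall]

theorem isArtinian_powTorsion [IsNoetherianRing R] [m.IsMaximal] (h : (powTorsion m X).FG) :
    IsArtinian R (powTorsion m X) := by
  obtain ⟨c, hc⟩ : ∃ c : ℕ, powTorsion m X ≤ Submodule.torsionBySet R X (m ^ c : Ideal R) := by
    obtain ⟨_, ⟨c, rfl⟩, hc⟩ := (CompleteLattice.isCompactElement_iff_le_of_directed_sSup_le _ _).1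
      ((Submodule.fg_iff_compact _).1 h) _ (Set.range_nonempty _)
      (directed_torsionBySet_pow m X).directedOn_range le_rfl
    exact ⟨c, hc⟩
  have : Module.Finite R (powTorsion m X) := .of_fg h
  exact isArtinian_of_pow_le_annihilator m (c := c) fun r hr ↦ Module.mem_annihilator.2
    fun x ↦ Subtype.ext ((Submodule.mem_torsionBySet_iff _ _).1 (hc x.2) ⟨r, hr⟩)

end PowTorsion

section

variable {R U X : Type*} [CommRing R] [Ring U] [SMul R U] [AddCommGroup X] [Module U X] [Module R X]
  [IsScalarTower R U X] {m : Ideal R} {x₀ : X}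

theorem le_of_inf_powTorsion_le (hx₀ : Submodule.span U {x₀} = ⊤) (hm : ∀ r ∈ m, r • x₀ = 0)
    (hsplit : ∀ x : X, ∃ e, e - 1 ∈ m ∧ e • x ∈ powTorsion m X) {P D : Submodule U X}
    (hP : IsCoatom P) (h : D.restrictScalars R ⊓ powTorsion m X ≤ P.restrictScalars R) :
    D ≤ P := by
  by_contra hD
  obtain ⟨p, hp, d, hd, hpd⟩ := Submodule.mem_sup.1
    (hP.2 (P ⊔ D) (left_lt_sup.2 hD) ▸ Submodule.mem_top : x₀ ∈ P ⊔ D)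
  obtain ⟨e, he, hed⟩ := hsplit d
  have hd' : e • d ∈ P.restrictScalars R := h ⟨(D.restrictScalars R).smul_mem e hd, hed⟩
  have hex₀ : e • x₀ = x₀ := by simpa only [sub_smul, one_smul, sub_eq_zero] using hm _ he
  refine hP.1 (top_le_iff.1 (hx₀ ▸ (Submodule.span_singleton_le_iff_mem _ _).2 ?_))
  rw [← hex₀, ← hpd, smul_add]
  exact add_mem ((P.restrictScalars R).smul_mem e hp) hd'

theorem exists_finset_coatom_quotient_equiv [IsNoetherianRing R] [m.IsMaximal]
    (hx₀ : Submodule.span U {x₀} = ⊤) (hm : ∀ r ∈ m, r • x₀ = 0)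
    (hsplit : ∀ x : X, ∃ e, e - 1 ∈ m ∧ e • x ∈ powTorsion m X) (hfg : (powTorsion m X).FG) :
    ∃ T : Finset (Submodule U X), ∀ P : Submodule U X, IsCoatom P →
      ∃ Q ∈ T, Nonempty ((X ⧸ P) ≃ₗ[U] X ⧸ Q) := by
  classical
  have := isArtinian_powTorsion hfg
  obtain ⟨s, hs⟩ := Finset.exists_inf_le fun P : {P : Submodule U X // IsCoatom P} ↦
    (P.1.restrictScalars R).comap (powTorsion m X).subtype
  refine ⟨s.image Subtype.val, fun P hP ↦ exists_linearEquiv_quotient_of_finset_inf_le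
    (by simp +contextual) hP (le_of_inf_powTorsion_le (R := R) hx₀ hm hsplit hP ?_)⟩
  rintro x ⟨hx, hx'⟩
  refine hs ⟨P, hP⟩ (?_ : (⟨x, hx'⟩ : powTorsion m X) ∈ _)
  simpa [Submodule.mem_finsetInf] using hx

end

end SimpleQuotients

section FiniteAlong

/-- The `A`-module `X` is finitely generated over `R`, acting through `f : R → A`. Since
`𝒜(m, n)` is studied through both embeddings of `Γ` into `Γ ⊗ Γ`, the homomorphism is kept
explicit. -/
def FiniteAlong {R A : Type*} [CommRing R] [CommRing A] (f : R →+* A) (X : Type*)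
    [AddCommGroup X] [Module A X] : Prop :=
  letI := Module.compHom X f
  Module.Finite R X

variable {R A X Y : Type*} [CommRing R] [CommRing A] [AddCommGroup X] [Module A X]
  [AddCommGroup Y] [Module A Y] {f : R →+* A}

theorem FiniteAlong.exists_fin (h : FiniteAlong f X) :
    ∃ (n : ℕ) (v : Fin n → X), ∀ x, ∃ c : Fin n → R, ∑ j, f (c j) • v j = x := by
  let := Module.compHom X f
  have : Module.Finite R X := h
  obtain ⟨n, v, hv⟩ := Module.Finite.exists_fin (R := R) (M := X)
  exact ⟨n, v, (Submodule.top_le_span_range_iff_forall_exists_fun R).1 hv.ge⟩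

theorem FiniteAlong.of_surjective (h : FiniteAlong f X) (g : X →ₗ[A] Y)
    (hg : Function.Surjective g) : FiniteAlong f Y := by
  let := Module.compHom X f
  let := Module.compHom Y f
  have : Module.Finite R X := h
  exact Module.Finite.of_surjective (⟨g, fun r x ↦ g.map_smul (f r) x⟩ : X →ₗ[R] Y) hg

theorem FiniteAlong.finite (h : FiniteAlong f X) : Module.Finite A X := by
  let := f.toAlgebra
  let := Module.compHom X f
  have : IsScalarTower R A X := ⟨fun r a x ↦ mul_smul (f r) a x⟩
  have : Module.Finite R X := h
  exact .of_restrictScalars_finite R A X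

theorem FiniteAlong.isArtinian [IsNoetherianRing R] (h : FiniteAlong f X) (m : Ideal R)
    [m.IsMaximal] (hm : m ≤ (Module.annihilator A X).comap f) : IsArtinian A X := by
  let := f.toAlgebra
  let := Module.compHom X f
  have : IsScalarTower R A X := ⟨fun r a x ↦ mul_smul (f r) a x⟩
  have : Module.Finite R X := h
  have : IsArtinian R X := isArtinian_of_pow_le_annihilator m (c := 1) fun r hr ↦
    Module.mem_annihilator.2 (Module.mem_annihilator.1 (hm (pow_one m ▸ hr)))
  exact isArtinian_of_tower R this

theorem FiniteAlong.isIntegral_apply {B : Type*} [CommRing B] [IsDomain B] [Algebra R B]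
    (h : FiniteAlong f X) {θ : A →+* B} (hθ : θ.comp f = algebraMap R B) {C : X →+ B}
    (hC : ∀ a x, C (a • x) = θ a * C x) (hC₀ : C ≠ 0) (a : A) : IsIntegral R (θ a) := by
  let := f.toAlgebra
  let := Module.compHom X f
  have : IsScalarTower R A X := ⟨fun r a x ↦ mul_smul (f r) a x⟩
  have : Module.Finite R X := h
  obtain ⟨p, hp, hpa⟩ := Algebra.IsIntegral.isIntegral (R := R) (Algebra.lsmul R R X a)
  obtain ⟨x, hx⟩ := DFunLike.ne_iff.1 hC₀
  have hpax : Polynomial.aeval a p • x = 0 := by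
    rw [← Polynomial.aeval_def, Polynomial.aeval_algHom_apply] at hpa
    exact LinearMap.congr_fun hpa x
  refine ⟨p, hp, ?_⟩
  rw [← hθ, ← Polynomial.hom_eval₂]
  refine (mul_eq_zero.1 ((hC _ x).symm.trans ?_)).resolve_right hx
  rw [← map_zero C, ← hpax]
  rfl

theorem IsLeftFG.finiteAlong {S : Type*} [Ring S] {j : R →+* S} {W : AddSubgroup S}
    (h : IsLeftFG j W) (e : X ≃+ W) (he : ∀ r x, (e (f r • x) : S) = j r * e x) :
    FiniteAlong f X := by
  let := leftModule j
  let := Module.compHom X f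
  obtain ⟨P, hP, rfl⟩ := h
  have : Module.Finite R P := .of_fg hP
  let e' : X →ₗ[R] P := { e with map_smul' := fun r x ↦ Subtype.ext (he r x) }
  exact Module.Finite.equiv (LinearEquiv.ofBijective e' e.bijective).symm

theorem IsRightFG.finiteAlong {S : Type*} [Ring S] {j : R →+* S} {W : AddSubgroup S}
    (h : IsRightFG j W) (e : X ≃+ W) (he : ∀ r x, (e (f r • x) : S) = e x * j r) :
    FiniteAlong f X := by
  let := rightModule j
  let := Module.compHom X f
  obtain ⟨P, hP, rfl⟩ := h
  have : Module.Finite Rᵐᵒᵖ P := .of_fg hP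
  let e' : P →ₛₗ[((RingEquiv.toOpposite R).symm : Rᵐᵒᵖ →+* R)] X :=
    { e.symm with
      map_smul' := fun r x ↦ e.symm_apply_eq.2 (Subtype.ext ((he r.unop (e.symm x)).trans
        (congrArg (fun y : P ↦ (y : S) * j r.unop) (e.apply_symm_apply x))).symm) }
  exact Module.Finite.of_surjective e' e.symm.surjective

end FiniteAlong

section Coefficients

variable {k L : Type*} [Field k] [Field L] [Algebra k L] {M : Submonoid (L ≃ₐ[k] L)}

section

variable {A : Type*} [CommRing A] [Algebra k A] [Algebra A L] [IsScalarTower k A L]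

theorem coeff_coeffEmb_mul (a : A) (x : SkewMonoidAlgebra L M) (φ : M) :
    (coeffEmb A M a * x).coeff φ = algebraMap A L a * x.coeff φ :=
  SkewMonoidAlgebra.coeff_single_one_mul x _ φ

theorem coeff_mul_coeffEmb (a : A) (x : SkewMonoidAlgebra L M) (φ : M) :
    (x * coeffEmb A M a).coeff φ = x.coeff φ * (φ : L ≃ₐ[k] L) (algebraMap A L a) :=
  SkewMonoidAlgebra.coeff_mul_single_one x _ φ

end

theorem fg_of_coeff_eq_zero {S V : Type*} [Ring S] [IsNoetherianRing S]
    [Module S (SkewMonoidAlgebra L M)] [AddCommGroup V] [Module S V] [Module.Finite S V]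
    {P : Submodule S (SkewMonoidAlgebra L M)} {T : Set M} (hT : T.Finite)
    (hP : ∀ x ∈ P, ∀ φ ∉ T, x.coeff φ = 0) (e : M → L ≃+ V)
    (he : ∀ φ (s : S) (x : SkewMonoidAlgebra L M), e φ ((s • x).coeff φ) = s • e φ (x.coeff φ)) :
    P.FG := by
  have := hT.to_subtype
  let c : P →ₗ[S] T → V :=
    { toFun := fun x φ ↦ e φ (x.1.coeff φ)
      map_add' := fun x y ↦ funext fun φ ↦ by simp
      map_smul' := fun s x ↦ funext fun φ ↦ he φ s x }
  refine Module.Finite.iff_fg.1 (Module.Finite.of_injective c fun x y h ↦ ?_)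
  ext φ
  by_cases hφ : φ ∈ T
  · exact (e φ).injective (congrFun h ⟨φ, hφ⟩)
  · rw [hP _ x.2 φ hφ, hP _ y.2 φ hφ]

variable (K : Type*) [Field K] [Algebra K L] [Algebra k K] [IsScalarTower k K L]

/-- The invariants with support in `T`: the one-sided `K`-subspace to which the order condition
of a Galois order is applied. -/
def invariantsOn (T : Set M) : AddSubgroup (SkewMonoidAlgebra L M) where
  carrier := {x | x ∈ invariants K M ∧ ∀ φ ∉ T, x.coeff φ = 0}
  add_mem' hx hy := ⟨add_mem hx.1 hy.1, fun φ hφ ↦ by simp [hx.2 φ hφ, hy.2 φ hφ]⟩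
  zero_mem' := ⟨zero_mem _, fun φ _ ↦ by simp⟩
  neg_mem' hx := ⟨neg_mem hx.1, fun φ hφ ↦ by simp [hx.2 φ hφ]⟩

variable {K}

theorem coeffEmb_mul_mem_invariants (a : K) {x : SkewMonoidAlgebra L M}
    (hx : x ∈ invariants K M) : coeffEmb K M a * x ∈ invariants K M := by
  intro g φ ψ h
  rw [coeff_coeffEmb_mul, coeff_coeffEmb_mul, hx g φ ψ h, map_mul, AlgEquiv.commutes]

theorem mul_coeffEmb_mem_invariants (a : K) {x : SkewMonoidAlgebra L M}
    (hx : x ∈ invariants K M) : x * coeffEmb K M a ∈ invariants K M := by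
  intro g φ ψ h
  have hψ : (ψ : L ≃ₐ[k] L) (algebraMap K L a) = g ((φ : L ≃ₐ[k] L) (algebraMap K L a)) := by
    rw [h]
    exact congrArg (fun y ↦ g ((φ : L ≃ₐ[k] L) y)) (g.symm.commutes a)
  rw [coeff_mul_coeffEmb, coeff_mul_coeffEmb, hx g φ ψ h, map_mul, hψ]

variable [FiniteDimensional K L] {T : Set M}

theorem isLeftFG_invariantsOn (hT : T.Finite) :
    IsLeftFG (coeffEmb K M : K →+* _) (invariantsOn K T) := by
  let := leftModule (coeffEmb K M : K →+* SkewMonoidAlgebra L M)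
  let P : Submodule K (SkewMonoidAlgebra L M) :=
    { invariantsOn K T with
      smul_mem' := fun a x hx ↦ ⟨coeffEmb_mul_mem_invariants a hx.1, fun φ hφ ↦
        (coeff_coeffEmb_mul a x φ).trans (by rw [hx.2 φ hφ, mul_zero])⟩ }
  exact ⟨P, fg_of_coeff_eq_zero hT (fun x hx ↦ hx.2) (fun _ ↦ .refl L) fun φ a x ↦
    (coeff_coeffEmb_mul a x φ).trans (Algebra.smul_def a _).symm, rfl⟩

theorem isRightFG_invariantsOn (hT : T.Finite) :
    IsRightFG (coeffEmb K M : K →+* _) (invariantsOn K T) := by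
  let := rightModule (coeffEmb K M : K →+* SkewMonoidAlgebra L M)
  let P : Submodule Kᵐᵒᵖ (SkewMonoidAlgebra L M) :=
    { invariantsOn K T with
      smul_mem' := fun a x hx ↦ ⟨mul_coeffEmb_mem_invariants a.unop hx.1, fun φ hφ ↦
        (coeff_mul_coeffEmb a.unop x φ).trans (by rw [hx.2 φ hφ, zero_mul])⟩ }
  let : Module Kᵐᵒᵖ L := Module.compHom L ((RingEquiv.toOpposite K).symm : Kᵐᵒᵖ →+* K)
  have : IsScalarTower K Kᵐᵒᵖ L := ⟨fun a b x ↦ mul_smul a b.unop x⟩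
  have : Module.Finite Kᵐᵒᵖ L := .of_restrictScalars_finite K _ _
  refine ⟨P, fg_of_coeff_eq_zero hT (fun x hx ↦ hx.2)
    (fun φ ↦ (φ : L ≃ₐ[k] L).symm.toAddEquiv) fun φ a x ↦ ?_, rfl⟩
  change (φ : L ≃ₐ[k] L).symm ((x * coeffEmb K M a.unop).coeff φ) =
    a.unop • (φ : L ≃ₐ[k] L).symm (x.coeff φ)
  rw [coeff_mul_coeffEmb, map_mul, AlgEquiv.symm_apply_apply, mul_comm, Algebra.smul_def]

end Coefficients

section Bimodule

variable {k Γ U : Type*} [Field k] [CommRing Γ] [Algebra k Γ] [Ring U] [Algebra k U]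
  {i : Γ →ₐ[k] U}

variable (k Γ) in
/-- The embedding `γ ↦ γ ⊗ 1`, through which the left action of `Γ` on a bimodule factors. -/
abbrev inclLeft : Γ →+* Γ ⊗[k] Γ :=
  ((Algebra.TensorProduct.includeLeft : Γ →ₐ[k] Γ ⊗[k] Γ) : Γ →+* Γ ⊗[k] Γ)

variable (k Γ) in
/-- The embedding `γ ↦ 1 ⊗ γ`, through which the right action of `Γ` on a bimodule factors. -/
abbrev inclRight : Γ →+* Γ ⊗[k] Γ :=
  ((Algebra.TensorProduct.includeRight : Γ →ₐ[k] Γ ⊗[k] Γ) : Γ →+* Γ ⊗[k] Γ)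

theorem Bimod.toRing_inclLeft_smul (γ : Γ) (u : Bimod i) :
    Bimod.toRing i (inclLeft k Γ γ • u) = i γ * Bimod.toRing i u :=
  (Bimod.toRing_tmul_smul γ 1 u).trans (by rw [map_one, mul_one])

theorem Bimod.toRing_inclRight_smul (γ : Γ) (u : Bimod i) :
    Bimod.toRing i (inclRight k Γ γ • u) = Bimod.toRing i u * i γ :=
  (Bimod.toRing_tmul_smul 1 γ u).trans (by rw [map_one, one_mul])

open Algebra.TensorProduct in
theorem exists_isPrime_of_ker_productMap_sup_biIdeal_ne_top {B : Type*} [CommRing B] [Algebra k B]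
    {f g : Γ →ₐ[k] B} (hf : (f : Γ →+* B).IsIntegral) {m n : MaximalSpectrum Γ}
    (h : RingHom.ker (productMap f g) ⊔ biIdeal k m n ≠ ⊤) :
    ∃ q : Ideal B, q.IsPrime ∧ n.asIdeal ≤ q.comap f ∧ m.asIdeal ≤ q.comap g := by
  obtain ⟨p, hp, hle⟩ := Ideal.exists_le_maximal _ h
  let := (productMap f g : Γ ⊗[k] Γ →+* B).toAlgebra
  have : Algebra.IsIntegral (Γ ⊗[k] Γ) B := ⟨RingHom.IsIntegral.tower_top (inclLeft k Γ) _ <| by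
    convert hf
    ext γ
    exact productMap_left_apply f g γ⟩
  obtain ⟨q, hq, rfl⟩ := Ideal.exists_ideal_over_maximal_of_isIntegral p (le_sup_left.trans hle)
  have hn := Ideal.map_le_iff_le_comap.1 (le_sup_left.trans (le_sup_right.trans hle))
  have hm := Ideal.map_le_iff_le_comap.1 (le_sup_right.trans (le_sup_right.trans hle))
  refine ⟨q, hq.isPrime, fun γ hγ ↦ ?_, fun γ hγ ↦ ?_⟩
  · exact Ideal.mem_comap.2 (productMap_left_apply f g γ ▸ Ideal.mem_comap.1 (hn hγ))
  · exact Ideal.mem_comap.2 (productMap_right_apply (f := f) g γ ▸ Ideal.mem_comap.1 (hm hγ))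

end Bimodule

section Support

variable {k L : Type*} [Field k] [Field L] [Algebra k L]
  {K : Type*} [Field K] [Algebra K L] [Algebra k K] [IsScalarTower k K L]
  {Γ : Type*} [CommRing Γ] [Algebra k Γ] [Algebra Γ L] [IsScalarTower k Γ L]
  {M : Submonoid (L ≃ₐ[k] L)} {U : Subalgebra k (SkewMonoidAlgebra L M)}

variable (Γ) in
/-- The character `γ ⊗ δ ↦ γ φ(δ)` by which `Γ ⊗ Γ` acts on the coefficient at `φ`. -/
noncomputable def twistHom (φ : L ≃ₐ[k] L) : Γ ⊗[k] Γ →ₐ[k] L :=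
  Algebra.TensorProduct.productMap (IsScalarTower.toAlgHom k Γ L)
    ((φ : L →ₐ[k] L).comp (IsScalarTower.toAlgHom k Γ L))

theorem twistHom_tmul (φ : L ≃ₐ[k] L) (γ δ : Γ) :
    twistHom Γ φ (γ ⊗ₜ δ) = algebraMap Γ L γ * φ (algebraMap Γ L δ) := rfl

/-- The coefficient at `φ` of an element of a Galois ring. -/
noncomputable def coeffAt (hU : IsGaloisRing K Γ M U) (φ : M) : Bimod hU.incl →+ L where
  toFun u := (Bimod.toRing hU.incl u : SkewMonoidAlgebra L M).coeff φ
  map_zero' := by simp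
  map_add' u v := by simp

variable (hU : IsGaloisRing K Γ M U)

theorem coeffAt_smul (φ : M) (a : Γ ⊗[k] Γ) (u : Bimod hU.incl) :
    coeffAt hU φ (a • u) = twistHom Γ φ a * coeffAt hU φ u := by
  induction a using TensorProduct.induction_on with
  | zero => simp only [zero_smul, map_zero, zero_mul]
  | add a b ha hb => simp only [add_smul, map_add, add_mul, ha, hb]
  | tmul γ δ =>
    change (Bimod.toRing hU.incl ((γ ⊗ₜ[k] δ) • u) : SkewMonoidAlgebra L M).coeff φ =
      _ * (Bimod.toRing hU.incl u : SkewMonoidAlgebra L M).coeff φ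
    rw [Bimod.toRing_tmul_smul, twistHom_tmul, mul_right_comm, ← coeff_coeffEmb_mul]
    exact coeff_mul_coeffEmb δ _ φ

theorem mem_supportSub {S : Set M} {u : Bimod hU.incl} :
    u ∈ supportSub hU S ↔ ∀ φ ∉ S, coeffAt hU φ u = 0 :=
  forall_congr' fun _ ↦ not_imp_comm

/-- `U(T)`, as an additive group, is the intersection with `U` of the invariants supported in
`T`. -/
noncomputable def supportSubEquiv (T : Set M) :
    supportSub hU T ≃+ ↥(invariantsOn K T ⊓ (Subalgebra.toSubmodule U).toAddSubgroup) where
  toFun u := ⟨(Bimod.toRing hU.incl u : SkewMonoidAlgebra L M),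
    ⟨hU.le_invariants (Bimod.toRing hU.incl u).2, (mem_supportSub hU).1 u.2⟩,
    (Bimod.toRing hU.incl u).2⟩
  invFun x := ⟨(Bimod.toRing hU.incl).symm ⟨x, x.2.2⟩, (mem_supportSub hU).2 x.2.1.2⟩
  left_inv _ := rfl
  right_inv _ := rfl
  map_add' _ _ := rfl

theorem exists_finite_le_supportSub {V : Submodule (Γ ⊗[k] Γ) (Bimod hU.incl)} (hV : V.FG) :
    ∃ T : Set M, T.Finite ∧ V ≤ supportSub hU T ∧ ∀ φ ∈ T, coeffAt hU φ ≠ 0 := by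
  obtain ⟨F, rfl⟩ := hV
  refine ⟨⋃ u ∈ F, {φ | coeffAt hU φ u ≠ 0},
    Set.Finite.biUnion F.finite_toSet fun u _ ↦ Finsupp.hasFiniteSupport _,
    Submodule.span_le.2 fun u hu φ hφ ↦ Set.mem_biUnion hu hφ, fun φ hφ hφ₀ ↦ ?_⟩
  obtain ⟨u, -, hu⟩ := Set.mem_iUnion₂.1 hφ
  exact hu (DFunLike.congr_fun hφ₀ u)

theorem exists_finite_coeffAt_comp_subtype_ne_zero {φ : M} (hφ : coeffAt hU φ ≠ 0) :
    ∃ T : Set M, T.Finite ∧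
      (coeffAt hU φ).comp (supportSub hU T).subtype.toAddMonoidHom ≠ 0 := by
  obtain ⟨u, hu⟩ := DFunLike.ne_iff.1 hφ
  obtain ⟨T, hT, hle, -⟩ :=
    exists_finite_le_supportSub hU (Submodule.fg_span (Set.finite_singleton u))
  exact ⟨T, hT, DFunLike.ne_iff.2 ⟨⟨u, hle (Submodule.mem_span_singleton_self u)⟩, hu⟩⟩

end Support

section GaloisOrder

variable {k L : Type*} [Field k] [Field L] [Algebra k L]
  {K : Type*} [Field K] [Algebra K L] [Algebra k K] [IsScalarTower k K L] [FiniteDimensional K L]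
  {Γ : Type*} [CommRing Γ] [Algebra k Γ] [Algebra Γ L] [IsScalarTower k Γ L]
  {M : Submonoid (L ≃ₐ[k] L)} {U : Subalgebra k (SkewMonoidAlgebra L M)}

theorem finiteAlong_inclLeft_supportSub (hU : IsGaloisOrder K Γ M U) {T : Set M}
    (hT : T.Finite) : FiniteAlong (inclLeft k Γ) (supportSub hU.toIsGaloisRing T) :=
  (hU.left_order (invariantsOn K T) (fun _ hx ↦ hx.1) (isLeftFG_invariantsOn hT)).finiteAlong
    (supportSubEquiv hU.toIsGaloisRing T) fun γ u ↦
      congrArg Subtype.val (Bimod.toRing_inclLeft_smul γ u.1)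

theorem finiteAlong_inclRight_supportSub (hU : IsGaloisOrder K Γ M U) {T : Set M}
    (hT : T.Finite) : FiniteAlong (inclRight k Γ) (supportSub hU.toIsGaloisRing T) :=
  (hU.right_order (invariantsOn K T) (fun _ hx ↦ hx.1) (isRightFG_invariantsOn hT)).finiteAlong
    (supportSubEquiv hU.toIsGaloisRing T) fun γ u ↦
      congrArg Subtype.val (Bimod.toRing_inclRight_smul γ u.1)

theorem isIntegral_twistHom (hU : IsGaloisOrder K Γ M U) {φ : M}
    (hφ : coeffAt hU.toIsGaloisRing φ ≠ 0) (a : Γ ⊗[k] Γ) :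
    IsIntegral Γ (twistHom Γ (φ : L ≃ₐ[k] L) a) := by
  obtain ⟨T, hT, hC⟩ := exists_finite_coeffAt_comp_subtype_ne_zero hU.toIsGaloisRing hφ
  refine (finiteAlong_inclLeft_supportSub hU hT).isIntegral_apply
    (θ := (twistHom Γ (φ : L ≃ₐ[k] L) : Γ ⊗[k] Γ →+* L)) ?_
    (fun a u ↦ coeffAt_smul hU.toIsGaloisRing φ a u) hC a
  ext γ
  exact (twistHom_tmul _ γ 1).trans (by rw [map_one, map_one, mul_one])

theorem isIntegral_symm_twistHom (hU : IsGaloisOrder K Γ M U) {φ : M}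
    (hφ : coeffAt hU.toIsGaloisRing φ ≠ 0) (a : Γ ⊗[k] Γ) :
    IsIntegral Γ ((φ : L ≃ₐ[k] L).symm (twistHom Γ (φ : L ≃ₐ[k] L) a)) := by
  obtain ⟨T, hT, hC⟩ := exists_finite_coeffAt_comp_subtype_ne_zero hU.toIsGaloisRing hφ
  let σ : L ≃+ L := (φ : L ≃ₐ[k] L).symm.toAddEquiv
  refine (finiteAlong_inclRight_supportSub hU hT).isIntegral_apply
    (θ := (((φ : L ≃ₐ[k] L).symm : L →ₐ[k] L).comp (twistHom Γ (φ : L ≃ₐ[k] L)) :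
      Γ ⊗[k] Γ →+* L)) (C := (σ : L →+ L).comp ((coeffAt hU.toIsGaloisRing φ).comp
        (supportSub hU.toIsGaloisRing T).subtype.toAddMonoidHom)) ?_ (fun a u ↦ ?_)
    (fun h ↦ hC (AddMonoidHom.ext fun u ↦ σ.map_eq_zero_iff.1 (DFunLike.congr_fun h u))) a
  · ext δ
    refine (congrArg (φ : L ≃ₐ[k] L).symm (twistHom_tmul _ 1 δ)).trans ?_
    rw [map_one, one_mul, AlgEquiv.symm_apply_apply]
  · exact (congrArg σ (coeffAt_smul hU.toIsGaloisRing φ a u)).trans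
      (map_mul (φ : L ≃ₐ[k] L).symm _ _)

theorem isIntegral_map_of_isIntegral_algebraMap {R B C : Type*} [CommRing R] [CommRing B]
    [CommRing C] [Algebra R B] [Algebra R C] (f : B →+* C)
    (hf : ∀ r, IsIntegral R (f (algebraMap R B r))) {x : B} (hx : IsIntegral R x) :
    IsIntegral R (f x) := by
  let g : R →+* integralClosure R C := (f.comp (algebraMap R B)).codRestrict _ hf
  exact isIntegral_trans (A := integralClosure R C) _ (hx.map_of_comp_eq g f rfl)

theorem isIntegral_apply_iff (hU : IsGaloisOrder K Γ M U) {φ : M}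
    (hφ : coeffAt hU.toIsGaloisRing φ ≠ 0) {x : L} :
    IsIntegral Γ ((φ : L ≃ₐ[k] L) x) ↔ IsIntegral Γ x := by
  refine ⟨fun hx ↦ ?_,
    isIntegral_map_of_isIntegral_algebraMap ((φ : L ≃ₐ[k] L) : L →+* L) fun δ ↦ ?_⟩
  · rw [← (φ : L ≃ₐ[k] L).symm_apply_apply x]
    refine isIntegral_map_of_isIntegral_algebraMap ((φ : L ≃ₐ[k] L).symm : L →+* L)
      (fun γ ↦ ?_) hx
    have h := isIntegral_symm_twistHom hU hφ (γ ⊗ₜ 1)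
    rwa [twistHom_tmul, map_one, map_one, mul_one] at h
  · have h := isIntegral_twistHom hU hφ (1 ⊗ₜ δ)
    rwa [twistHom_tmul, map_one, one_mul] at h

end GaloisOrder

section Link

variable {K L : Type*} [Field K] [Field L] [Algebra K L] [FiniteDimensional K L] [IsGalois K L]
  {Γ : Type*} [CommRing Γ] [Algebra Γ L] [Algebra Γ K] [IsScalarTower Γ K L] [IsFractionRing Γ K]
  [IsIntegrallyClosed Γ] {m n : MaximalSpectrum Γ} {ℓm ℓn : MaximalSpectrum (integralClosure Γ L)}

theorem exists_image_coe_eq_image_idealSet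
    (hm : ℓm.asIdeal.comap (algebraMap Γ (integralClosure Γ L)) = m.asIdeal)
    {q : Ideal (integralClosure Γ L)} (hq : q.IsPrime)
    (hmq : m.asIdeal ≤ q.comap (algebraMap Γ (integralClosure Γ L))) :
    ∃ g : L ≃ₐ[K] L, (fun x : integralClosure Γ L ↦ (x : L)) '' q = g '' idealSet ℓm := by
  have hmq' : m.asIdeal = q.comap (algebraMap Γ (integralClosure Γ L)) :=
    m.isMaximal.eq_of_le (Ideal.comap_ne_top _ hq.ne_top) hmq
  have : IsDomain Γ := (IsFractionRing.injective Γ K).isDomain _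
  have := ℓm.isMaximal.isPrime
  have : SMulCommClass (L ≃ₐ[K] L) Γ L := ⟨fun g γ x ↦ by
    rw [← algebraMap_smul K γ x, ← algebraMap_smul K γ (g • x)]
    exact map_smul g _ _⟩
  have : Algebra.IsInvariant Γ (integralClosure Γ L) (L ≃ₐ[K] L) := ⟨fun b hb ↦ by
    obtain ⟨a, ha⟩ := (IsGalois.mem_range_algebraMap_iff_fixed (b : L)).2 fun g ↦
      congrArg Subtype.val (hb g)
    obtain ⟨γ, rfl⟩ := IsIntegrallyClosed.algebraMap_eq_of_integral
      ((isIntegral_algebraMap_iff (algebraMap K L).injective).1 (ha ▸ b.2 : IsIntegral Γ _))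
    exact ⟨γ, Subtype.ext ((IsScalarTower.algebraMap_apply Γ K L γ).trans ha)⟩⟩
  obtain ⟨g, rfl⟩ := Algebra.IsInvariant.exists_smul_of_under_eq Γ (integralClosure Γ L)
    (L ≃ₐ[K] L) ℓm.asIdeal q (hm.trans hmq')
  refine ⟨g, ?_⟩
  rw [idealSet, Set.image_image]
  ext y
  constructor
  · rintro ⟨x, hx, rfl⟩
    exact ⟨g⁻¹ • x, Ideal.mem_pointwise_smul_iff_inv_smul_mem.1 hx,
      congrArg Subtype.val (smul_inv_smul g x)⟩
  · rintro ⟨x, hx, rfl⟩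
    exact ⟨g • x, Ideal.smul_mem_pointwise_smul g x _ hx, rfl⟩

variable {k : Type*} [Field k] [Algebra k L] {M : Submonoid (L ≃ₐ[k] L)}

theorem mem_linkSet_of_image_eq
    (hm : ℓm.asIdeal.comap (algebraMap Γ (integralClosure Γ L)) = m.asIdeal)
    (hn : ℓn.asIdeal.comap (algebraMap Γ (integralClosure Γ L)) = n.asIdeal)
    {φ : M} {p q : Ideal (integralClosure Γ L)} (hp : p.IsPrime) (hq : q.IsPrime)
    (hmp : m.asIdeal ≤ p.comap (algebraMap Γ (integralClosure Γ L)))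
    (hnq : n.asIdeal ≤ q.comap (algebraMap Γ (integralClosure Γ L)))
    (h : (φ : L ≃ₐ[k] L) '' ((fun x : integralClosure Γ L ↦ (x : L)) '' p) =
      (fun x : integralClosure Γ L ↦ (x : L)) '' q) : φ ∈ linkSet K M ℓm ℓn := by
  obtain ⟨g₁, h₁⟩ := exists_image_coe_eq_image_idealSet (K := K) hm hp hmp
  obtain ⟨g₂, h₂⟩ := exists_image_coe_eq_image_idealSet (K := K) hn hq hnq
  exact ⟨g₁, g₂, by rw [← h₁, ← h₂, h]⟩

variable [Algebra k Γ] [IsScalarTower k Γ L]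

theorem ker_twistHom_sup_biIdeal
    (hm : ℓm.asIdeal.comap (algebraMap Γ (integralClosure Γ L)) = m.asIdeal)
    (hn : ℓn.asIdeal.comap (algebraMap Γ (integralClosure Γ L)) = n.asIdeal)
    {φ : M} (h : ∀ x : L, IsIntegral Γ ((φ : L ≃ₐ[k] L) x) ↔ IsIntegral Γ x)
    (hφ : φ ∉ linkSet K M ℓm ℓn) :
    RingHom.ker (twistHom Γ (φ : L ≃ₐ[k] L)) ⊔ biIdeal k m n = ⊤ := by
  let f : Γ →ₐ[k] integralClosure Γ L := IsScalarTower.toAlgHom k Γ _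
  let σ : integralClosure Γ L →ₐ[k] integralClosure Γ L :=
    (((φ : L ≃ₐ[k] L) : L →ₐ[k] L).comp
      (IsScalarTower.toAlgHom k (integralClosure Γ L) L)).codRestrict
        ((integralClosure Γ L).restrictScalars k) fun x ↦ (h x).2 x.2
  have hker : RingHom.ker (Algebra.TensorProduct.productMap f (σ.comp f)) =
      RingHom.ker (twistHom Γ (φ : L ≃ₐ[k] L)) := by
    have : twistHom Γ (φ : L ≃ₐ[k] L) = (IsScalarTower.toAlgHom k (integralClosure Γ L) L).comp
        (Algebra.TensorProduct.productMap f (σ.comp f)) := by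
      ext <;> simp [twistHom] <;> rfl
    rw [this]
    exact (RingHom.ker_comp_of_injective _ Subtype.val_injective).symm
  by_contra htop
  rw [← hker] at htop
  obtain ⟨q, hq, hnq, hmq⟩ := exists_isPrime_of_ker_productMap_sup_biIdeal_ne_top
    (algebraMap_isIntegral_iff.2 inferInstance) htop
  refine hφ (mem_linkSet_of_image_eq hm hn (hq.comap σ) hq hmq hnq (Set.ext fun y ↦ ?_))
  constructor
  · rintro ⟨-, ⟨x, hx, rfl⟩, rfl⟩
    exact ⟨σ x, hx, rfl⟩
  · rintro ⟨x, hx, rfl⟩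
    have hφx := (φ : L ≃ₐ[k] L).apply_symm_apply (x : L)
    let z : integralClosure Γ L := ⟨(φ : L ≃ₐ[k] L).symm x, (h _).1 (hφx.symm ▸ x.2)⟩
    exact ⟨z, ⟨z, (congrArg (· ∈ q) (Subtype.ext hφx : σ z = x)).mpr hx, rfl⟩, hφx⟩

variable [Algebra k K] [IsScalarTower k K L] {U : Subalgebra k (SkewMonoidAlgebra L M)}

theorem exists_smul_mem_supportSub (hU : IsGaloisOrder K Γ M U)
    (hm : ℓm.asIdeal.comap (algebraMap Γ (integralClosure Γ L)) = m.asIdeal)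
    (hn : ℓn.asIdeal.comap (algebraMap Γ (integralClosure Γ L)) = n.asIdeal)
    {V : Submodule (Γ ⊗[k] Γ) (Bimod hU.incl)} (hV : V.FG) :
    ∃ f : Γ ⊗[k] Γ, 1 - f ∈ biIdeal k m n ∧
      ∀ v ∈ V, f • v ∈ supportSub hU.toIsGaloisRing (linkSet K M ℓm ℓn) := by
  obtain ⟨T, hT, hVT, hT₀⟩ := exists_finite_le_supportSub hU.toIsGaloisRing hV
  let F := (hT.sdiff (t := linkSet K M ℓm ℓn)).toFinset
  have htop : biIdeal k m n ⊔
      ⨅ φ ∈ F, RingHom.ker (twistHom Γ ((φ : M) : L ≃ₐ[k] L)) = ⊤ :=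
    Ideal.sup_iInf_eq_top fun φ hφ ↦ by
      rw [Set.Finite.mem_toFinset] at hφ
      rw [sup_comm]
      exact ker_twistHom_sup_biIdeal hm hn (fun x ↦ isIntegral_apply_iff hU (hT₀ φ hφ.1)) hφ.2
  obtain ⟨a, ha, f, hf, haf⟩ := Submodule.mem_sup.1 ((Ideal.eq_top_iff_one _).1 htop)
  refine ⟨f, by rwa [← haf, add_sub_cancel_right], fun v hv ↦
    (mem_supportSub hU.toIsGaloisRing).2 fun φ hφ ↦ ?_⟩
  rw [coeffAt_smul]
  by_cases hφT : φ ∈ T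
  · have : twistHom Γ (φ : L ≃ₐ[k] L) f = 0 :=
      (Submodule.mem_iInf _).1 ((Submodule.mem_iInf _).1 hf φ) (by simpa [F] using ⟨hφT, hφ⟩)
    rw [this, zero_mul]
  · rw [(mem_supportSub hU.toIsGaloisRing).1 (hVT hv) φ hφT, mul_zero]

end Link

section SimpleModules

theorem exists_sub_one_mem_pow_mul_smul_eq_zero {R A X : Type*} [CommRing R] [IsNoetherianRing R]
    [CommRing A] [Algebra R A] [AddCommGroup X] [Module R X] [Module A X] [IsScalarTower R A X]
    [Module.Finite R X] [IsArtinian A X] (m : Ideal R) :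
    ∃ e, e - 1 ∈ m ∧ ∃ c : ℕ, ∀ r ∈ m ^ c, ∀ x : X, (r * e) • x = 0 := by
  obtain ⟨c, hc⟩ := IsArtinian.monotone_stabilizes (R := A) (M := X)
    ⟨fun c ↦ OrderDual.toDual (m.map (algebraMap R A) ^ c • ⊤), fun _ _ h ↦
      Submodule.smul_mono_left (Ideal.pow_le_pow_right h)⟩
  have hc' : (m ^ c • ⊤ : Submodule R X) = m ^ (c + 1) • ⊤ := by
    have := congrArg (Submodule.restrictScalars R) (OrderDual.toDual.injective (hc _ c.le_succ))
    rwa [← Ideal.map_pow, ← Ideal.map_pow, Ideal.smul_restrictScalars,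
      Ideal.smul_restrictScalars, Submodule.restrictScalars_top] at this
  obtain ⟨e, he, h⟩ := Submodule.exists_sub_one_mem_and_smul_eq_zero_of_fg_of_le_smul m
    (m ^ c • ⊤ : Submodule R X) (IsNoetherian.noetherian _)
    (by rw [← Submodule.mul_smul, ← pow_succ', ← hc'])
  refine ⟨e, he, c, fun r hr x ↦ ?_⟩
  rw [mul_comm, mul_smul]
  exact h _ (Submodule.smul_mem_smul hr Submodule.mem_top)

theorem exists_smul_smul_eq_of_one_sub_mem_sup {A X : Type*} [CommRing A] [AddCommGroup X]
    [Module A X] {I J : Ideal A} {x : X} {c : ℕ} (hI : I ^ c ≤ Ideal.torsionOf A X x)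
    (hJ : J ≤ Ideal.torsionOf A X x) {f : A} (hf : 1 - f ∈ I ⊔ J) : ∃ a : A, a • f • x = x := by
  have hpow : (1 - f) ^ (c + 1) ∈ Ideal.torsionOf A X x :=
    (Ideal.sup_pow_add_le_pow_sup_pow.trans (sup_le hI ((pow_one J).le.trans hJ)))
      (Ideal.pow_mem_pow hf _)
  obtain ⟨a, ha⟩ := sub_dvd_pow_sub_pow 1 (1 - f) (c + 1)
  rw [one_pow, sub_sub_cancel] at ha
  refine ⟨a, ?_⟩
  rw [← mul_smul, mul_comm, ← ha, sub_smul, one_smul, (Ideal.mem_torsionOf_iff _ _).1 hpow,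
    sub_zero]

variable {k Γ U : Type*} [Field k] [CommRing Γ] [Algebra k Γ] [Ring U] [Algebra k U]
  (i : Γ →ₐ[k] U) (m : MaximalSpectrum Γ)

/-- The left ideal `U m`. The quotient `U / U m` is the universal `U`-module generated by a vector
killed by `m`. -/
def weightIdeal : Submodule U U := Submodule.span U (i '' m.asIdeal)

variable {i m}

theorem mul_mem_weightIdeal_of_mem {γ : Γ} (hγ : γ ∈ m.asIdeal) (u : U) :
    u * i γ ∈ weightIdeal i m :=
  (weightIdeal i m).smul_mem u (Submodule.subset_span ⟨γ, hγ, rfl⟩)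

theorem mul_mem_weightIdeal {u : U} (hu : u ∈ weightIdeal i m) (γ : Γ) :
    u * i γ ∈ weightIdeal i m := by
  suffices h : weightIdeal i m ≤ (weightIdeal i m).comap (LinearMap.toSpanSingleton U U (i γ)) from
    h hu
  refine Submodule.span_le.2 ?_
  rintro _ ⟨δ, hδ, rfl⟩
  refine Submodule.mem_comap.2 ?_
  rw [LinearMap.toSpanSingleton_apply, smul_eq_mul, ← map_mul, mul_comm, map_mul]
  exact mul_mem_weightIdeal_of_mem hδ _

variable (i m) in
/-- The left ideal `U m`, as a subbimodule of `U`. -/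
def weightSub : Submodule (Γ ⊗[k] Γ) (Bimod i) where
  __ := (weightIdeal i m).toAddSubgroup.comap (Bimod.toRing i : Bimod i →+ U)
  smul_mem' a u hu := by
    refine (?_ : Bimod.toRing i (a • u) ∈ weightIdeal i m)
    induction a using TensorProduct.induction_on with
    | zero => simpa only [zero_smul, map_zero] using zero_mem _
    | add a b ha hb => simpa only [add_smul, map_add] using add_mem ha hb
    | tmul γ δ =>
      rw [Bimod.toRing_tmul_smul]
      exact mul_mem_weightIdeal ((weightIdeal i m).smul_mem (i γ) hu) δ

theorem inclLeft_smul_mem_weightSub {γ : Γ} {u : Bimod i} :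
    inclLeft k Γ γ • u ∈ weightSub i m ↔ i γ * Bimod.toRing i u ∈ weightIdeal i m := by
  rw [← Bimod.toRing_inclLeft_smul]
  rfl

theorem inclRight_smul_mem_weightSub {γ : Γ} (hγ : γ ∈ m.asIdeal) (u : Bimod i) :
    inclRight k Γ γ • u ∈ weightSub i m := by
  refine (?_ : Bimod.toRing i (inclRight k Γ γ • u) ∈ weightIdeal i m)
  rw [Bimod.toRing_inclRight_smul]
  exact mul_mem_weightIdeal_of_mem hγ _

theorem exists_sub_one_mem_mul_mem_weightIdeal [IsNoetherianRing Γ]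
    {V : Submodule (Γ ⊗[k] Γ) (Bimod i)} (hl : FiniteAlong (inclLeft k Γ) V)
    (hr : FiniteAlong (inclRight k Γ) V) {u : Bimod i} (hu : u ∈ V) :
    ∃ e : Γ, e - 1 ∈ m.asIdeal ∧ ∃ c : ℕ, ∀ γ ∈ m.asIdeal ^ c,
      i (γ * e) * Bimod.toRing i u ∈ weightIdeal i m := by
  let X := V ⧸ (weightSub i m).comap V.subtype
  have hl : FiniteAlong (inclLeft k Γ) X := hl.of_surjective _ (Submodule.mkQ_surjective _)
  have hr : FiniteAlong (inclRight k Γ) X := hr.of_surjective _ (Submodule.mkQ_surjective _)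
  have := m.isMaximal
  have : IsArtinian (Γ ⊗[k] Γ) X := hr.isArtinian m.asIdeal fun γ hγ ↦
    Module.mem_annihilator.2 fun x ↦ by
      obtain ⟨v, rfl⟩ := Submodule.mkQ_surjective _ x
      exact (Submodule.Quotient.mk_eq_zero _).2 (inclRight_smul_mem_weightSub hγ (v : Bimod i))
  let := Module.compHom X (inclLeft k Γ)
  have : IsScalarTower Γ (Γ ⊗[k] Γ) X := ⟨fun γ a x ↦ by
    rw [Algebra.smul_def, mul_smul]
    rfl⟩
  have : Module.Finite Γ X := hl
  obtain ⟨e, he, c, hc⟩ :=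
    exists_sub_one_mem_pow_mul_smul_eq_zero (A := Γ ⊗[k] Γ) (X := X) m.asIdeal
  exact ⟨e, he, c, fun γ hγ ↦ inclLeft_smul_mem_weightSub.1
    ((Submodule.Quotient.mk_eq_zero ((weightSub i m).comap V.subtype)).1
      (hc γ hγ (Submodule.Quotient.mk ⟨u, hu⟩)))⟩

theorem exists_mem_sub_mem_weightSub {W : Submodule (Γ ⊗[k] Γ) (Bimod i)} {u : Bimod i}
    {f : Γ ⊗[k] Γ} (hf : 1 - f ∈ biIdeal k m m) (hW : f • u ∈ W) {c : ℕ}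
    (hc : ∀ γ ∈ m.asIdeal ^ c, i γ * Bimod.toRing i u ∈ weightIdeal i m) :
    ∃ w ∈ W, w - u ∈ weightSub i m := by
  have hl : m.asIdeal.map (inclLeft k Γ) ^ c ≤ Ideal.torsionOf _ _ ((weightSub i m).mkQ u) := by
    rw [← Ideal.map_pow, Ideal.map_le_iff_le_comap]
    exact fun γ hγ ↦ (Submodule.Quotient.mk_eq_zero _).2 (inclLeft_smul_mem_weightSub.2 (hc γ hγ))
  have hr : m.asIdeal.map (inclRight k Γ) ≤ Ideal.torsionOf _ _ ((weightSub i m).mkQ u) :=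
    Ideal.map_le_iff_le_comap.2 fun γ hγ ↦
      (Submodule.Quotient.mk_eq_zero _).2 (inclRight_smul_mem_weightSub hγ u)
  obtain ⟨a, ha⟩ := exists_smul_smul_eq_of_one_sub_mem_sup hl hr hf
  exact ⟨a • f • u, W.smul_mem a hW, (Submodule.Quotient.eq _).1 ha⟩

theorem exists_finset_coatom_weightIdeal_quotient_equiv [IsNoetherianRing Γ]
    (hV : ∀ u : Bimod i, ∃ V : Submodule (Γ ⊗[k] Γ) (Bimod i),
      u ∈ V ∧ FiniteAlong (inclLeft k Γ) V ∧ FiniteAlong (inclRight k Γ) V)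
    {W : Submodule (Γ ⊗[k] Γ) (Bimod i)} (hW : FiniteAlong (inclLeft k Γ) W)
    (hf : ∀ u : Bimod i, ∃ f : Γ ⊗[k] Γ, 1 - f ∈ biIdeal k m m ∧ f • u ∈ W) :
    ∃ T : Finset (Submodule U (U ⧸ weightIdeal i m)),
      ∀ P : Submodule U (U ⧸ weightIdeal i m), IsCoatom P → ∃ Q ∈ T,
        Nonempty (((U ⧸ weightIdeal i m) ⧸ P) ≃ₗ[U] (U ⧸ weightIdeal i m) ⧸ Q) := by
  have := m.isMaximal
  let := leftModule (i : Γ →+* U)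
  have : IsScalarTower Γ U U := ⟨fun γ u v ↦ mul_assoc (i γ) u v⟩
  let := Module.compHom W (inclLeft k Γ)
  have : Module.Finite Γ W := hW
  let q : W →ₗ[Γ] U ⧸ weightIdeal i m :=
    { toFun := fun w ↦ (weightIdeal i m).mkQ (Bimod.toRing i w)
      map_add' := fun _ _ ↦ rfl
      map_smul' := fun γ w ↦
        congrArg (weightIdeal i m).mkQ (Bimod.toRing_inclLeft_smul γ (w : Bimod i)) }
  have hq : powTorsion m.asIdeal (U ⧸ weightIdeal i m) ≤ q.range := fun x hx ↦ by
    obtain ⟨u, rfl⟩ := (weightIdeal i m).mkQ_surjective x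
    obtain ⟨c, hc⟩ := mem_powTorsion.1 hx
    obtain ⟨f, hf, hfW⟩ := hf ((Bimod.toRing i).symm u)
    obtain ⟨w, hw, hwu⟩ := exists_mem_sub_mem_weightSub hf hfW fun γ hγ ↦
      (Submodule.Quotient.mk_eq_zero _).1 (hc γ hγ)
    exact ⟨⟨w, hw⟩, (Submodule.Quotient.eq _).2 hwu⟩
  refine exists_finset_coatom_quotient_equiv (R := Γ) (m := m.asIdeal)
    (x₀ := (weightIdeal i m).mkQ 1) ?_ (fun γ hγ ↦ ?_) (fun x ↦ ?_) ?_
  · rw [← Set.image_singleton, ← Submodule.map_span, ← Ideal.span, Ideal.span_singleton_one,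
      Submodule.map_top, Submodule.range_mkQ]
  · refine (Submodule.Quotient.mk_eq_zero _).2 (?_ : i γ * 1 ∈ _)
    rw [mul_one, ← one_mul (i γ)]
    exact mul_mem_weightIdeal_of_mem hγ 1
  · obtain ⟨u, rfl⟩ := (weightIdeal i m).mkQ_surjective x
    obtain ⟨V, hu, hl, hr⟩ := hV ((Bimod.toRing i).symm u)
    obtain ⟨e, he, c, hc⟩ := exists_sub_one_mem_mul_mem_weightIdeal hl hr hu
    refine ⟨e, he, mem_powTorsion.2 ⟨c, fun γ hγ ↦ ?_⟩⟩
    rw [← mul_smul]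
    exact (Submodule.Quotient.mk_eq_zero _).2 (hc γ hγ)
  · exact (Module.Finite.fg_top.map q).of_le (Submodule.map_top q ▸ hq)

theorem HasWeight.exists_smul_eq_zero {N : Type*} [AddCommGroup N] [Module U N]
    (h : HasWeight i m N) : ∃ v : N, v ≠ 0 ∧ ∀ γ ∈ m.asIdeal, i γ • v = 0 := by
  obtain ⟨v, hv, r, hr⟩ := h
  induction r generalizing v with
  | zero => exact absurd (by simpa using hr 1 (by simp)) hv
  | succ r ih =>
    by_cases h : ∀ γ ∈ m.asIdeal ^ r, i γ • v = 0
    · exact ih v hv h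
    · push Not at h
      obtain ⟨γ, hγ, hγv⟩ := h
      refine ⟨i γ • v, hγv, fun δ hδ ↦ ?_⟩
      rw [← mul_smul, ← map_mul]
      exact hr _ (pow_succ' m.asIdeal r ▸ Ideal.mul_mem_mul hδ hγ)

theorem HasWeight.exists_weightIdeal_quotient_equiv {N : Type*} [AddCommGroup N] [Module U N]
    [IsSimpleModule U N] (h : HasWeight i m N) :
    ∃ P : Submodule U (U ⧸ weightIdeal i m), IsCoatom P ∧
      Nonempty (N ≃ₗ[U] (U ⧸ weightIdeal i m) ⧸ P) := by
  obtain ⟨v, hv, hvm⟩ := h.exists_smul_eq_zero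
  let q : (U ⧸ weightIdeal i m) →ₗ[U] N :=
    (weightIdeal i m).liftQ (LinearMap.toSpanSingleton U N v) (Submodule.span_le.2 (by
      rintro _ ⟨γ, hγ, rfl⟩
      exact hvm γ hγ))
  have hq : Function.Surjective q := fun x ↦ by
    obtain ⟨u, hu⟩ := IsSimpleModule.toSpanSingleton_surjective U hv x
    exact ⟨Submodule.Quotient.mk u, hu⟩
  exact ⟨q.ker, LinearMap.isCoatom_ker_of_surjective hq,
    ⟨(q.quotKerEquivOfSurjective hq).symm⟩⟩

theorem exists_finset_simple_hasWeight [IsNoetherianRing Γ]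
    (hV : ∀ u : Bimod i, ∃ V : Submodule (Γ ⊗[k] Γ) (Bimod i),
      u ∈ V ∧ FiniteAlong (inclLeft k Γ) V ∧ FiniteAlong (inclRight k Γ) V)
    {W : Submodule (Γ ⊗[k] Γ) (Bimod i)} (hW : FiniteAlong (inclLeft k Γ) W)
    (hf : ∀ u : Bimod i, ∃ f : Γ ⊗[k] Γ, 1 - f ∈ biIdeal k m m ∧ f • u ∈ W) :
    ∃ s : Finset (Submodule U U), ∀ (N : Type*) [AddCommGroup N] [Module U N],
      IsSimpleModule U N → HasWeight i m N → ∃ P ∈ s, Nonempty (N ≃ₗ[U] U ⧸ P) := by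
  classical
  obtain ⟨T, hT⟩ := exists_finset_coatom_weightIdeal_quotient_equiv hV hW hf
  refine ⟨T.image fun Q ↦ (Q.mkQ ∘ₗ (weightIdeal i m).mkQ).ker, fun N _ _ _ hN ↦ ?_⟩
  obtain ⟨P, hP, ⟨eP⟩⟩ := hN.exists_weightIdeal_quotient_equiv
  obtain ⟨Q, hQ, ⟨eQ⟩⟩ := hT P hP
  exact ⟨_, Finset.mem_image_of_mem _ hQ, ⟨eP ≪≫ₗ eQ ≪≫ₗ
    (LinearMap.quotKerEquivOfSurjective (Q.mkQ ∘ₗ (weightIdeal i m).mkQ)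
      (Q.mkQ_surjective.comp (weightIdeal i m).mkQ_surjective)).symm⟩⟩

end SimpleModules

section HomSpace

theorem isUnit_algebraMap_adicCompletion {A : Type*} [CommRing A] {I : Ideal A} {f : A}
    (hf : 1 - f ∈ I) : IsUnit (algebraMap A (AdicCompletion I A) f) := by
  let g : ℕ → A := fun a ↦ ∑ b ∈ Finset.range a, (1 - f) ^ b
  have hg (a) : f * g a = 1 - (1 - f) ^ a := by
    simpa only [sub_sub_cancel] using mul_neg_geom_sum (1 - f) a
  have hpow (a) : (1 - f) ^ a ∈ (I ^ a • ⊤ : Ideal A) := by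
    rw [smul_eq_mul, Ideal.mul_top]
    exact Ideal.pow_mem_pow hf a
  refine .of_mul_eq_one (AdicCompletion.mk I A (.mk I A g fun a ↦ ?_))
    (AdicCompletion.ext fun a ↦ (Submodule.Quotient.eq _).2 (?_ : f * g a - 1 ∈ _))
  · rw [SModEq.sub_mem, show g (a + 1) = g a + (1 - f) ^ a from Finset.sum_range_succ _ _,
      sub_add_cancel_left]
    exact neg_mem (hpow a)
  · rw [hg, sub_sub_cancel_left]
    exact neg_mem (hpow a)

theorem adicCompletionMap_smul_apply {A V W : Type*} [CommRing A] [AddCommGroup V] [Module A V]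
    [AddCommGroup W] [Module A W] (I : Ideal A) (f : A) (h : V →ₗ[A] W) (x : AdicCompletion I V) :
    AdicCompletion.map I (f • h) x = AdicCompletion.map I h (f • x) := by
  obtain ⟨x, rfl⟩ := AdicCompletion.mk_surjective I V x
  rw [← map_smul, AdicCompletion.map_mk, AdicCompletion.map_mk]
  exact congrArg (AdicCompletion.mk I W) (AdicCompletion.AdicCauchySequence.ext fun a ↦
    (map_smul h f _).symm)

variable {k Γ U : Type*} [Field k] [CommRing Γ] [Algebra k Γ] [Ring U] [Algebra k U]
  {i : Γ →ₐ[k] U} {m n : MaximalSpectrum Γ}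

theorem HomSpace.of_map {V W : FGSub i} (h : V ≤ W) (x : AdicCompletion (biIdeal k m n) V.1) :
    HomSpace.of i m n W (AdicCompletion.map (biIdeal k m n) (Submodule.inclusion h) x) =
      HomSpace.of i m n V x :=
  Module.DirectLimit.of_f

theorem HomSpace.of_of (V : FGSub i) (v : V.1) :
    HomSpace.of i m n V (AdicCompletion.of (biIdeal k m n) _ v) = HomSpace.ofElem i m n v := by
  have h : (⟨Submodule.span _ {(v : Bimod i)}, Submodule.fg_span (Set.finite_singleton _)⟩ :
      FGSub i) ≤ V := Submodule.span_le.2 (Set.singleton_subset_iff.2 v.2)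
  rw [HomSpace.ofElem, ← HomSpace.of_map h, AdicCompletion.map_of]
  rfl

instance : Nonempty (FGSub i) := ⟨⟨⊥, Submodule.fg_bot⟩⟩

instance : IsDirectedOrder (FGSub i) :=
  ⟨fun V W ↦ ⟨⟨V.1 ⊔ W.1, V.2.sup W.2⟩, le_sup_left (a := V.1), le_sup_right (a := V.1)⟩⟩

theorem HomSpace.of_surjective (W : FGSub i)
    (hW : ∀ V : FGSub i, ∃ f : Γ ⊗[k] Γ, 1 - f ∈ biIdeal k m n ∧ ∀ v ∈ V.1, f • v ∈ W.1) :
    Function.Surjective (HomSpace.of i m n W) := by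
  intro z
  obtain ⟨V, y, rfl⟩ : ∃ V y, HomSpace.of i m n V y = z := Module.DirectLimit.exists_of z
  obtain ⟨f, hf, hfW⟩ := hW V
  obtain ⟨e, he⟩ := (isUnit_algebraMap_adicCompletion hf).exists_right_inv
  let g : V.1 →ₗ[Γ ⊗[k] Γ] W.1 := (f • V.1.subtype).codRestrict W.1 fun v ↦ hfW v v.2
  let V' : FGSub i := ⟨V.1 ⊔ W.1, V.2.sup W.2⟩
  have hV : V ≤ V' := le_sup_left (a := V.1)
  have hWV : W ≤ V' := le_sup_right (a := V.1)
  have hg : Submodule.inclusion hWV ∘ₗ g = f • Submodule.inclusion hV := rfl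
  refine ⟨AdicCompletion.map _ g (e • y), ?_⟩
  rw [← HomSpace.of_map hV, ← HomSpace.of_map hWV, AdicCompletion.map_comp_apply, hg,
    adicCompletionMap_smul_apply, ← algebraMap_smul (BiCompletion k m n) f (e • y), smul_smul, he,
    one_smul]

theorem HomSpace.exists_eq_sum_completionMap_smul_ofElem {R : Type*} [CommRing R]
    [IsNoetherianRing R] {J : Ideal R} [J.IsMaximal] {f : R →+* Γ ⊗[k] Γ}
    (hJ : J ≤ (biIdeal k m n).comap f) {W : FGSub i}
    (hW : Function.Surjective (HomSpace.of i m n W)) (hf : FiniteAlong f W.1) :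
    ∃ (r : ℕ) (v : Fin r → W.1), ∀ z : HomSpace i m n, ∃ c : Fin r → AdicCompletion J R,
      z = ∑ j, completionMap J (biIdeal k m n) f hJ (c j) • HomSpace.ofElem i m n (v j) := by
  obtain ⟨r, v, hv⟩ := hf.exists_fin
  refine ⟨r, v, fun z ↦ ?_⟩
  obtain ⟨x, rfl⟩ := hW z
  obtain ⟨c, rfl⟩ := exists_eq_sum_completionMap_smul_of J (biIdeal k m n) f hJ v hv x
  exact ⟨c, by simp only [map_sum, map_smul, HomSpace.of_of]⟩

theorem HomSpace.exists_finite_span_left_eq_top [IsNoetherianRing Γ] {W : FGSub i}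
    (hW : Function.Surjective (HomSpace.of i m n W)) (hl : FiniteAlong (inclLeft k Γ) W.1) :
    ∃ s ⊆ (W.1 : Set (Bimod i)), s.Finite ∧
      Submodule.span (AdicCompletion n.asIdeal Γ) (HomSpace.ofElem i m n '' s) = ⊤ := by
  have := n.isMaximal
  obtain ⟨r, v, hv⟩ := HomSpace.exists_eq_sum_completionMap_smul_ofElem
    (Ideal.le_comap_of_map_le le_sup_left) hW hl
  refine ⟨Set.range fun j ↦ (v j : Bimod i), Set.range_subset_iff.2 fun j ↦ (v j).2,
    Set.finite_range _, top_le_iff.1 fun z _ ↦ ?_⟩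
  obtain ⟨c, rfl⟩ := hv z
  exact sum_mem fun j _ ↦ Submodule.smul_mem _ (c j)
    (Submodule.subset_span (Set.mem_image_of_mem _ ⟨j, rfl⟩))

theorem HomSpace.exists_finite_span_right_eq_top [IsNoetherianRing Γ] {W : FGSub i}
    (hW : Function.Surjective (HomSpace.of i m n W)) (hr : FiniteAlong (inclRight k Γ) W.1) :
    ∃ s ⊆ (W.1 : Set (Bimod i)), s.Finite ∧
      Submodule.span (AdicCompletion m.asIdeal Γ)ᵐᵒᵖ (HomSpace.ofElem i m n '' s) = ⊤ := by
  have := m.isMaximal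
  obtain ⟨r, v, hv⟩ := HomSpace.exists_eq_sum_completionMap_smul_ofElem
    (Ideal.le_comap_of_map_le le_sup_right) hW hr
  refine ⟨Set.range fun j ↦ (v j : Bimod i), Set.range_subset_iff.2 fun j ↦ (v j).2,
    Set.finite_range _, top_le_iff.1 fun z _ ↦ ?_⟩
  obtain ⟨c, rfl⟩ := hv z
  exact sum_mem fun j _ ↦ Submodule.smul_mem _ (MulOpposite.op (c j))
    (Submodule.subset_span (Set.mem_image_of_mem _ ⟨j, rfl⟩))

theorem HomSpace.finite_and_span_left_eq_top [IsNoetherianRing Γ] {W : FGSub i}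
    (hW : Function.Surjective (HomSpace.of i m n W)) (hl : FiniteAlong (inclLeft k Γ) W.1) :
    Module.Finite (AdicCompletion n.asIdeal Γ) (HomSpace i m n) ∧
      Submodule.span (AdicCompletion n.asIdeal Γ) (HomSpace.ofElem i m n '' W.1) = ⊤ := by
  obtain ⟨s, hsW, hs, h⟩ := HomSpace.exists_finite_span_left_eq_top hW hl
  exact ⟨⟨Submodule.fg_def.2 ⟨_, hs.image _, h⟩⟩,
    top_le_iff.1 (h.ge.trans (Submodule.span_mono (Set.image_mono hsW)))⟩

theorem HomSpace.finite_and_span_right_eq_top [IsNoetherianRing Γ] {W : FGSub i}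
    (hW : Function.Surjective (HomSpace.of i m n W)) (hr : FiniteAlong (inclRight k Γ) W.1) :
    Module.Finite (AdicCompletion m.asIdeal Γ)ᵐᵒᵖ (HomSpace i m n) ∧
      Submodule.span (AdicCompletion m.asIdeal Γ)ᵐᵒᵖ (HomSpace.ofElem i m n '' W.1) = ⊤ := by
  obtain ⟨s, hsW, hs, h⟩ := HomSpace.exists_finite_span_right_eq_top hW hr
  exact ⟨⟨Submodule.fg_def.2 ⟨_, hs.image _, h⟩⟩,
    top_le_iff.1 (h.ge.trans (Submodule.span_mono (Set.image_mono hsW)))⟩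

theorem HomSpace.finite_biCompletion (h : Module.Finite (AdicCompletion n.asIdeal Γ)
    (HomSpace i m n)) : Module.Finite (BiCompletion k m n) (HomSpace i m n) :=
  FiniteAlong.finite (f := leftHom k m n) h

end HomSpace

section LinkSet

variable {k L : Type*} [Field k] [Field L] [Algebra k L]
  {K : Type*} [Field K] [Algebra K L] [Algebra k K] [IsScalarTower k K L] [FiniteDimensional K L]
  {Γ : Type*} [CommRing Γ] [Algebra Γ L] {M : Submonoid (L ≃ₐ[k] L)}

open scoped Pointwise in
theorem finite_linkSet_self (hconj : ConjClosed K M)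
    {ℓm ℓn : MaximalSpectrum (integralClosure Γ L)} (hS : (linkSet K M ℓm ℓn).Finite)
    (hne : (linkSet K M ℓm ℓn).Nonempty) : (linkSet K M ℓm ℓm).Finite := by
  obtain ⟨ψ, h₁, h₂, hψ⟩ := hne
  -- If `ψ h₁ ℓm = h₂ ℓn` and `φ g₁ ℓm = g₂ ℓm`, then `ψ c φ c⁻¹`, for `c = h₁ g₂⁻¹`, takes
  -- `c g₁ ℓm` to `h₂ ℓn`.
  let c (g : L ≃ₐ[K] L) : L ≃ₐ[k] L := (h₁ * g⁻¹).restrictScalars k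
  let F (g : L ≃ₐ[K] L) (φ : M) : M := ψ * ⟨c g * φ * (c g)⁻¹, hconj (h₁ * g⁻¹) φ φ.2⟩
  have hF (g : L ≃ₐ[K] L) : Function.Injective (F g) := fun φ χ h ↦
    Subtype.ext (mul_left_cancel (mul_right_cancel (mul_left_cancel (congrArg Subtype.val h))))
  refine (Set.finite_iUnion fun g ↦ hS.preimage (hF g).injOn).subset ?_
  rintro φ ⟨g₁, g₂, h⟩
  refine Set.mem_iUnion.2 ⟨g₂, h₁ * g₂⁻¹ * g₁, h₂, ?_⟩
  change (ψ * (c g₂ * φ * (c g₂)⁻¹) : L ≃ₐ[k] L) • (h₁ * g₂⁻¹ * g₁) • idealSet ℓm =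
    h₂ • idealSet ℓn
  have hc (g : L ≃ₐ[K] L) (X : Set L) : c g • X = (h₁ * g⁻¹) • X := rfl
  have hc' (g : L ≃ₐ[K] L) (X : Set L) : (c g)⁻¹ • X = (h₁ * g⁻¹)⁻¹ • X := rfl
  have h' : (φ : L ≃ₐ[k] L) • g₁ • idealSet ℓm = g₂ • idealSet ℓm := h
  have hψ' : (ψ : L ≃ₐ[k] L) • h₁ • idealSet ℓm = h₂ • idealSet ℓn := hψ
  simp only [mul_smul, hc, hc', mul_inv_rev, inv_inv, inv_smul_smul, smul_inv_smul, h', hψ']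

variable [Algebra k Γ] [IsScalarTower k Γ L] {U : Subalgebra k (SkewMonoidAlgebra L M)}

theorem exists_mem_finiteAlong (hU : IsGaloisOrder K Γ M U) (u : Bimod hU.incl) :
    ∃ V : Submodule (Γ ⊗[k] Γ) (Bimod hU.incl),
      u ∈ V ∧ FiniteAlong (inclLeft k Γ) V ∧ FiniteAlong (inclRight k Γ) V := by
  obtain ⟨T, hT, h, -⟩ := exists_finite_le_supportSub hU.toIsGaloisRing
    (Submodule.fg_span (Set.finite_singleton u))
  exact ⟨_, h (Submodule.mem_span_singleton_self u), finiteAlong_inclLeft_supportSub hU hT,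
    finiteAlong_inclRight_supportSub hU hT⟩

theorem fg_supportSub (hU : IsGaloisOrder K Γ M U) {T : Set M} (hT : T.Finite) :
    (supportSub hU.toIsGaloisRing T).FG :=
  Module.Finite.iff_fg.1 (finiteAlong_inclLeft_supportSub hU hT).finite

variable [IsGalois K L] [Algebra Γ K] [IsScalarTower Γ K L] [IsFractionRing Γ K]
  [IsIntegrallyClosed Γ] {m n : MaximalSpectrum Γ} {ℓm ℓn : MaximalSpectrum (integralClosure Γ L)}

theorem HomSpace.of_supportSub_surjective (hU : IsGaloisOrder K Γ M U)
    (hm : ℓm.asIdeal.comap (algebraMap Γ (integralClosure Γ L)) = m.asIdeal)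
    (hn : ℓn.asIdeal.comap (algebraMap Γ (integralClosure Γ L)) = n.asIdeal)
    (hfg : (supportSub hU.toIsGaloisRing (linkSet K M ℓm ℓn)).FG) :
    Function.Surjective (HomSpace.of hU.incl m n ⟨_, hfg⟩) :=
  HomSpace.of_surjective _ fun V ↦ exists_smul_mem_supportSub hU hm hn V.2

theorem isBig_and_exists_finset_simple [IsNoetherianRing Γ] (hU : IsGaloisOrder K Γ M U)
    (hm : ℓm.asIdeal.comap (algebraMap Γ (integralClosure Γ L)) = m.asIdeal)
    (hS : (linkSet K M ℓm ℓm).Finite) : IsBig hU.incl m ∧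
      ∃ s : Finset (Submodule U U), ∀ (N : Type*) [AddCommGroup N] [Module U N],
        IsSimpleModule U N → HasWeight hU.incl m N → ∃ P ∈ s, Nonempty (N ≃ₗ[U] U ⧸ P) := by
  have hsurj := HomSpace.of_supportSub_surjective hU hm hm (fg_supportSub hU hS)
  have hr := HomSpace.finite_and_span_right_eq_top hsurj (finiteAlong_inclRight_supportSub hU hS)
  refine ⟨hr.1, exists_finset_simple_hasWeight (exists_mem_finiteAlong hU)
    (finiteAlong_inclLeft_supportSub hU hS) fun u ↦ ?_⟩
  obtain ⟨f, hf, h⟩ := exists_smul_mem_supportSub hU hm hm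
    (Submodule.fg_span (Set.finite_singleton u))
  exact ⟨f, hf, h u (Submodule.mem_span_singleton_self u)⟩

end LinkSet

end GaloisOrder

open GaloisOrder in
theorem mainTheorem5_general {k Γ K L : Type*} [Field k]
    [CommRing Γ] [IsNoetherianRing Γ] [IsIntegrallyClosed Γ] [Algebra k Γ]
    [Field K] [Algebra Γ K] [IsFractionRing Γ K] [Algebra k K]
    [Field L] [Algebra K L] [FiniteDimensional K L] [IsGalois K L]
    [Algebra k L] [IsScalarTower k K L] [Algebra Γ L] [IsScalarTower Γ K L]
    [IsScalarTower k Γ L]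
    (M : Submonoid (L ≃ₐ[k] L)) (hconj : ConjClosed K M)
    (U : Subalgebra k (SkewMonoidAlgebra L M)) (hU : IsGaloisOrder K Γ M U)
    (m n : MaximalSpectrum Γ) (ℓm ℓn : MaximalSpectrum (integralClosure Γ L))
    (hm : ℓm.asIdeal.comap (algebraMap Γ (integralClosure Γ L)) = m.asIdeal)
    (hn : ℓn.asIdeal.comap (algebraMap Γ (integralClosure Γ L)) = n.asIdeal)
    (hS : (linkSet K M ℓm ℓn).Finite) :
    Module.Finite (BiCompletion k m n) (HomSpace hU.incl m n) ∧
    Module.Finite (AdicCompletion n.asIdeal Γ) (HomSpace hU.incl m n) ∧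
    Module.Finite (AdicCompletion m.asIdeal Γ)ᵐᵒᵖ (HomSpace hU.incl m n) ∧
    (∃ hfg : (supportSub hU.toIsGaloisRing (linkSet K M ℓm ℓn)).FG,
      Function.Surjective (HomSpace.of hU.incl m n ⟨_, hfg⟩)) ∧
    Submodule.span (AdicCompletion n.asIdeal Γ) (HomSpace.ofElem hU.incl m n ''
      (supportSub hU.toIsGaloisRing (linkSet K M ℓm ℓn) : Set (Bimod hU.incl))) = ⊤ ∧
    Submodule.span (AdicCompletion m.asIdeal Γ)ᵐᵒᵖ (HomSpace.ofElem hU.incl m n ''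
      (supportSub hU.toIsGaloisRing (linkSet K M ℓm ℓn) : Set (Bimod hU.incl))) = ⊤ ∧
    ((linkSet K M ℓm ℓn).Nonempty → IsBig hU.incl m ∧
      ∃ s : Finset (Submodule U U), ∀ (N : Type*) [AddCommGroup N] [Module U N],
        IsSimpleModule U N → HasWeight hU.incl m N →
          ∃ P ∈ s, Nonempty (N ≃ₗ[U] U ⧸ P)) := by
  have hfg := fg_supportSub hU hS
  have hsurj := HomSpace.of_supportSub_surjective hU hm hn hfg
  have hl := HomSpace.finite_and_span_left_eq_top hsurj (finiteAlong_inclLeft_supportSub hU hS)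
  have hr := HomSpace.finite_and_span_right_eq_top hsurj (finiteAlong_inclRight_supportSub hU hS)
  exact ⟨HomSpace.finite_biCompletion hl.1, hl.1, hr.1, ⟨hfg, hsurj⟩, hl.2, hr.2,
    fun hne ↦ isBig_and_exists_finset_simple hU hm (finite_linkSet_self hconj hS hne)⟩

open GaloisOrder in
theorem mainTheorem5 {k Γ K L : Type*} [Field k] [IsAlgClosed k] [CharZero k]
    [CommRing Γ] [IsDomain Γ] [IsNoetherianRing Γ] [IsIntegrallyClosed Γ] [Algebra k Γ]
    [Field K] [Algebra Γ K] [IsFractionRing Γ K] [Algebra k K] [IsScalarTower k Γ K]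
    [Field L] [Algebra K L] [FiniteDimensional K L] [IsGalois K L]
    [Algebra k L] [IsScalarTower k K L] [Algebra Γ L] [IsScalarTower Γ K L]
    [IsScalarTower k Γ L]
    (M : Submonoid (L ≃ₐ[k] L)) (hconj : ConjClosed K M) (hsep : Separating K M)
    (U : Subalgebra k (SkewMonoidAlgebra L M)) (hU : IsGaloisOrder K Γ M U)
    (m n : MaximalSpectrum Γ) (ℓm ℓn : MaximalSpectrum (integralClosure Γ L))
    (hm : ℓm.asIdeal.comap (algebraMap Γ (integralClosure Γ L)) = m.asIdeal)
    (hn : ℓn.asIdeal.comap (algebraMap Γ (integralClosure Γ L)) = n.asIdeal)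
    (hS : (linkSet K M ℓm ℓn).Finite) :
    -- `𝒜(m, n)` is finitely generated as a completed bimodule, on the left and on the right
    Module.Finite (BiCompletion k m n) (HomSpace hU.incl m n) ∧
    Module.Finite (AdicCompletion n.asIdeal Γ) (HomSpace hU.incl m n) ∧
    Module.Finite (AdicCompletion m.asIdeal Γ)ᵐᵒᵖ (HomSpace hU.incl m n) ∧
    -- `𝒜(m, n)` is the image of the completion of `U(S)`
    (∃ hfg : (supportSub hU.toIsGaloisRing (linkSet K M ℓm ℓn)).FG,
      Function.Surjective (HomSpace.of hU.incl m n ⟨_, hfg⟩)) ∧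
    -- the image of `U(S)` itself generates `𝒜(m, n)` on the left and on the right
    Submodule.span (AdicCompletion n.asIdeal Γ) (HomSpace.ofElem hU.incl m n ''
      (supportSub hU.toIsGaloisRing (linkSet K M ℓm ℓn) : Set (Bimod hU.incl))) = ⊤ ∧
    Submodule.span (AdicCompletion m.asIdeal Γ)ᵐᵒᵖ (HomSpace.ofElem hU.incl m n ''
      (supportSub hU.toIsGaloisRing (linkSet K M ℓm ℓn) : Set (Bimod hU.incl))) = ⊤ ∧
    -- if `S(m, n)` is nonempty (always so for `n = m`), then `Γ` is big in `m`, and there are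
    -- finitely many isomorphism classes of simple `U`-modules with a nonzero `m`-component
    ((linkSet K M ℓm ℓn).Nonempty → IsBig hU.incl m ∧
      ∃ s : Finset (Submodule U U), ∀ (N : Type*) [AddCommGroup N] [Module U N],
        IsSimpleModule U N → HasWeight hU.incl m N →
          ∃ P ∈ s, Nonempty (N ≃ₗ[U] U ⧸ P)) :=
  mainTheorem5_general M hconj U hU m n ℓm ℓn hm hn hS
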